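/- **Setting.** Let $\mathcal G=(V,E)$ be a finite graph without loops, $|V|=n$, $|E|=m$, with an arbitrary orientation, and let $B\in\{0,\pm1\}^{n\times m}$ be its incidence matrix ($+1$ at the initial node of an edge, $-1$ at its terminal node). The storage levels $x\in\mathbb R^n$ obey $\dot x=B\lambda+Pw$, where $\lambda\in\mathbb R^m$ are the flows and the supply/demand is generated by the exosystem $\dot w=s(w)$, $w\in\mathbb R^r$. Assume: 1. There is a compact set $\mathcal W\subset\mathbb R^r$ that is forward invariant under $\dot w=s(w)$, and $w(0)\in\mathcal W$. 2. $\mathbf 1^{T}Pw(t)=0$ for all $t\ge 0$. 3. Each line $k\in E$ has a capacity $\bar\lambda_k\in(0,\infty]$ and a convex cost $\mathcal P_k:\mathbb R\to(-\infty,\infty]$ with $\mathcal P_k=\infty$ on $\{|\lambda_k|>\bar\lambda_k\}$. On $\{|\lambda_k|<\bar\lambda_k\}$ the cost $\mathcal P_k$ is finite, $C^\infty$ and strictly convex, with $\nabla^2\mathcal P_k>0$, and $|\nabla\mathcal P_k(\lambda^{[\ell]})|\to\infty$ for every sequence in $\{|\lambda_k|<\bar\lambda_k\}$ with $|\lambda^{[\ell]}|\to\bar\lambda_k$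 (also when $\bar\lambda_k=\infty$). 4. For every node set $\emptyset\ne S\subsetneq V$, the sum of the capacities of the edges with exactly one end in $S$ is $\infty$. Hence each $\nabla\mathcal P_k$ is a bijection from $\{|\lambda_k|<\bar\lambda_k\}$ onto $\mathbb R$. Write $\mathcal P(\lambda)=\sum_k\mathcal P_k(\lambda_k)$, let $\nabla\mathcal P^{-1}$ be the componentwise inverse gradient and $H(\zeta)=\mathrm{diag}(h_k)$ with $h_k=(\nabla\mathcal P_k^{-1})'((B^T\zeta)_k)>0$. For a spanning tree with edge set $T$ put $h(T)=\prod_{k\in T}h_k$, and let $\bar h$ be the sum of $h(T)$ over all spanning trees. Let $X(\zeta)\in\mathbb R^{m\times n}$ have entries $X_{ki}=\bar h^{-1}\sum_T h(T)$, summed over the spanning trees $T\ni k$ for which $i$ lies in the component of $T\setminus\{k\}$ containing the initial node of $k$. Put $$\Xi(\zeta)=X(\zeta)^T H(\zeta)^{-1}B^T(BB^T)^\dagger,\qquad Q=I-\tfrac1n\mathbf 1\mathbf 1^T,$$ $$\Gamma=\{(\lambda,w)\in\mathbb R^m\times\mathcal W:\ |\lambda_k|<\bar\lambda_k\ \text{for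 all } k,\ \nabla\mathcal P(\lambda)\in\mathcal R(B^T),\ B\lambda+Pw=0\},$$ where $\dagger$ denotes the Moore–Penrose inverse and $\mathcal R$ the range. **Theorem 1 (Feedback Controller).** For every $k>0$ the dynamic controller $$\dot\zeta=-Q\,\Xi(\zeta)\Bigl(Ps(w)+x+k\bigl(B\nabla\mathcal P^{-1}(B^T\zeta)+Pw\bigr)\Bigr),\qquad \lambda=\nabla\mathcal P^{-1}(B^T\zeta)-B^Tx$$ solves the time-varying optimal distribution problem for all initial values $x(0)$ and $\zeta(0)$. That is, every solution $(x,w,\zeta)$ of the closed loop on an interval $[0,\tau)$, $\tau\le\infty$, is bounded there, and every solution on $[0,\infty)$ satisfies (i) $\lim_{t\to\infty}B^Tx(t)=0$, and (ii) $\lim_{t\to\infty}\mathrm{dist}_\Gamma(\lambda(t),w(t))=0$. Moreover, let $$U(t)=\tfrac12\|x(t)-x^w\|^2+\tfrac12\|B\nabla\mathcal P^{-1}(B^T\zeta(t))+Pw(t)\|^2,\qquad x^w=\tfrac1n\bigl(\mathbf 1^Tx(0)\bigr)\mathbf 1,$$ and $\sigma=\min\{s_2,k\}>0$, where $s_2$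 is the smallest non-zero eigenvalue of $BB^T$ ($\sigma=k$ if there is none). Then $U(t)\le e^{-\sigma t}\,U(0)$ on the interval of existence of every closed-loop solution. -/

import Mathlib

open Set Filter Topology
open scoped ENNReal ContDiff Matrix

/-- A finite graph with a fixed (arbitrary) orientation: edge `k` runs from its initial node
`src k` to its terminal node `tgt k`. There are no loops; parallel edges are allowed. -/
structure OrientedGraph (V E : Type*) where
  src : E → V
  tgt : E → V
  src_ne_tgt : ∀ k, src k ≠ tgt k

namespace OrientedGraph

variable {V E : Type*}

/-- The incidence matrix: `+1` at the initial node, `-1` at the terminal node, `0` otherwise. -/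
def incidence [DecidableEq V] (G : OrientedGraph V E) : Matrix V E ℝ :=
  Matrix.of fun i k => if G.src k = i then 1 else if G.tgt k = i then -1 else 0

open Classical in
/-- The edges of the cut induced by a node set `S`: those with exactly one end in `S`. -/
noncomputable def cut [Fintype E] (G : OrientedGraph V E) (S : Set V) : Finset E :=
  Finset.univ.filter fun k =>
    (G.src k ∈ S ∧ G.tgt k ∉ S) ∨ (G.tgt k ∈ S ∧ G.src k ∉ S)

/-- The capacity of the cut induced by `S`. -/
noncomputable def cutCapacity [Fintype E] (G : OrientedGraph V E) (cap : E → ℝ≥0∞)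
    (S : Set V) : ℝ≥0∞ :=
  ∑ k ∈ G.cut S, cap k

/-- The undirected adjacency of the subgraph `(V, T)`. -/
def sub (G : OrientedGraph V E) (T : Set E) : SimpleGraph V :=
  SimpleGraph.fromRel fun i j => ∃ k ∈ T, G.src k = i ∧ G.tgt k = j

/-- `T` is the edge set of a spanning tree: `(V, T)` is connected and acyclic, and
`|T| = |V| - 1`. (The last clause excludes parallel edges in `T`.) -/
def IsSpanningTree [Fintype V] (G : OrientedGraph V E) (T : Finset E) : Prop :=
  (G.sub (T : Set E)).IsTree ∧ T.card + 1 = Fintype.card V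

/-- The nodes of the component of `(V, T \ {l})` that contains the positive end of `l`. -/
def positiveSide (G : OrientedGraph V E) (T : Finset E) (l : E) : Set V :=
  {i | (G.sub ((T : Set E) \ {l})).Reachable (G.src l) i}

open Classical in
/-- The sum of the weights `∏ l ∈ T, h l` of all spanning trees `T`. -/
noncomputable def totalTreeWeight [Fintype V] [Fintype E] (G : OrientedGraph V E)
    (h : E → ℝ) : ℝ :=
  ∑ T : Finset E with G.IsSpanningTree T, ∏ l ∈ T, h l

open Classical in
/-- The matrix `X` solving the generalized Dirichlet problem with edge weights `h`: the entry
`(k, i)` is the normalized weight of all spanning trees that contain `k` and for which `i` lies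
on the positive side of `k`. -/
noncomputable def treeMatrix [Fintype V] [Fintype E] (G : OrientedGraph V E)
    (h : E → ℝ) : Matrix E V ℝ :=
  Matrix.of fun k i =>
    (1 / G.totalTreeWeight h) *
      ∑ T : Finset E with G.IsSpanningTree T ∧ k ∈ T ∧ i ∈ G.positiveSide T k, ∏ l ∈ T, h l

end OrientedGraph

/-- The Penrose equations: `M` is the generalized (Moore-Penrose) inverse of `A`. -/
structure IsMoorePenrose {m n : Type*} [Fintype m] [Fintype n]
    (A : Matrix m n ℝ) (M : Matrix n m ℝ) : Prop where
  mul_mul_left : A * M * A = A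
  mul_mul_right : M * A * M = M
  symm_left : (A * M)ᵀ = A * M
  symm_right : (M * A)ᵀ = M * A

theorem exists_isMoorePenrose {n : Type*} [Fintype n] [DecidableEq n]
    (A : Matrix n n ℝ) (hA : Aᵀ = A) : ∃ M, IsMoorePenrose A M := by
  have hsa : IsSelfAdjoint A := by
    rw [isSelfAdjoint_iff, Matrix.star_eq_conjTranspose, Matrix.conjTranspose_eq_transpose_of_trivial]
    exact hA
  have hc : ∀ f : ℝ → ℝ, ContinuousOn f (spectrum ℝ A) := fun f =>
    (Matrix.finite_real_spectrum (A := A)).continuousOn f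
  have hid : cfc (fun x : ℝ => x) A = A := cfc_id' ℝ A hsa
  have h1 : A * cfc (fun x : ℝ => x⁻¹) A = cfc (fun x : ℝ => x * x⁻¹) A := by
    conv_lhs => rw [← hid]
    rw [hid, cfc_mul (fun x : ℝ => x) (fun x : ℝ => x⁻¹) A (hc _) (hc _), hid]
  have h2 : cfc (fun x : ℝ => x⁻¹) A * A = cfc (fun x : ℝ => x⁻¹ * x) A := by
    rw [cfc_mul (fun x : ℝ => x⁻¹) (fun x : ℝ => x) A (hc _) (hc _), hid]
  have hsymm : ∀ f : ℝ → ℝ, (cfc f A)ᵀ = cfc f A := fun f => by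
    have h : IsSelfAdjoint (cfc f A) := cfc_predicate f A
    rw [isSelfAdjoint_iff, Matrix.star_eq_conjTranspose,
      Matrix.conjTranspose_eq_transpose_of_trivial] at h
    exact h
  refine ⟨cfc (fun x : ℝ => x⁻¹) A, ?_, ?_, ?_, ?_⟩
  · rw [h1]
    conv_lhs => rw [← hid]
    rw [hid]
    calc cfc (fun x : ℝ => x * x⁻¹) A * A
        = cfc (fun x : ℝ => x * x⁻¹ * x) A := by
          rw [cfc_mul (fun x : ℝ => x * x⁻¹) (fun x : ℝ => x) A (hc _) (hc _), hid]
      _ = A := by simp only [mul_inv_mul_cancel, hid]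
  · rw [h2, ← cfc_mul _ _ A (hc _) (hc _)]
    congr 1
    funext x
    by_cases hx : x = 0
    · simp [hx]
    · field_simp
  · rw [h1]; exact hsymm _
  · rw [h2]; exact hsymm _

theorem transpose_mul_transpose_self {m n : Type*} [Fintype n] (B : Matrix m n ℝ) :
    (B * Bᵀ)ᵀ = B * Bᵀ := by
  rw [Matrix.transpose_mul, Matrix.transpose_transpose]

/-- The generalized (Moore-Penrose) inverse of `B Bᵀ`. -/
noncomputable def gramPinv {m n : Type*} [Fintype m] [DecidableEq m] [Fintype n]
    (B : Matrix m n ℝ) : Matrix m m ℝ :=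
  Classical.choose (exists_isMoorePenrose (B * Bᵀ) (transpose_mul_transpose_self B))

theorem gramPinv_spec {m n : Type*} [Fintype m] [DecidableEq m] [Fintype n]
    (B : Matrix m n ℝ) : IsMoorePenrose (B * Bᵀ) (gramPinv B) :=
  Classical.choose_spec (exists_isMoorePenrose (B * Bᵀ) (transpose_mul_transpose_self B))

/-- The open set `{s : -c < s < c}` of strictly feasible flows on a line with capacity
`c ∈ (0, ∞]`. -/
def flowInterval (c : ℝ≥0∞) : Set ℝ := {s | ENNReal.ofReal |s| < c}

/-- The gradient of an extended-real-valued cost (meaningful where the cost is finite and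
differentiable). -/
noncomputable def costGrad (p : ℝ → EReal) : ℝ → ℝ := deriv fun s => (p s).toReal

/-- A smooth convex flow cost of Legendre type on a line with capacity `c`: convex with values in
`(-∞, ∞]`, infinite beyond the capacity, and finite, smooth and strictly convex with positive
second derivative below it, with a gradient that blows up at the capacity. For `c = ∞` the last
condition concerns sequences of flows with `|λ| → ∞`. -/
structure IsLegendreCost (c : ℝ≥0∞) (p : ℝ → EReal) : Prop where
  convex : Convex ℝ {q : ℝ × ℝ | p q.1 ≤ (q.2 : EReal)}
  ne_bot : ∀ s, p s ≠ ⊥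
  eq_top : ∀ s, c < ENNReal.ofReal |s| → p s = ⊤
  ne_top : ∀ s ∈ flowInterval c, p s ≠ ⊤
  strictConvex : StrictConvexOn ℝ (flowInterval c) fun s => (p s).toReal
  smooth : ContDiffOn ℝ ∞ (fun s => (p s).toReal) (flowInterval c)
  hess_pos : ∀ s ∈ flowInterval c, 0 < deriv (costGrad p) s
  grad_blowup : ∀ u : ℕ → ℝ, (∀ l, u l ∈ flowInterval c) →
    Tendsto (fun l => ENNReal.ofReal |u l|) atTop (𝓝 c) →
    Tendsto (fun l => |costGrad p (u l)|) atTop atTop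

/-- The inverse of the gradient of the cost, as a map into the open flow interval. -/
noncomputable def gradInv (c : ℝ≥0∞) (p : ℝ → EReal) : ℝ → ℝ :=
  Function.invFunOn (costGrad p) (flowInterval c)

section Network

variable {V E R : Type*} [Fintype V] [DecidableEq V] [Fintype E] [DecidableEq E] [Fintype R]

/-- The vector `∇𝒫⁻¹(Bᵀ ζ)`. -/
noncomputable def dualFlow (G : OrientedGraph V E) (cap : E → ℝ≥0∞) (cost : E → ℝ → EReal)
    (ζ : V → ℝ) : E → ℝ :=
  fun k => gradInv (cap k) (cost k) ((G.incidenceᵀ *ᵥ ζ) k)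

/-- The diagonal of `D𝒫⁻¹(Bᵀ ζ)`: the derivatives of the inverse gradients at `Bᵀ ζ`. -/
noncomputable def edgeWeight (G : OrientedGraph V E) (cap : E → ℝ≥0∞) (cost : E → ℝ → EReal)
    (ζ : V → ℝ) : E → ℝ :=
  fun k => deriv (gradInv (cap k) (cost k)) ((G.incidenceᵀ *ᵥ ζ) k)

/-- The matrix `Ξ(ζ) = X(ζ)ᵀ H(ζ)⁻¹ Bᵀ (B Bᵀ)†`, where `H(ζ) = D𝒫⁻¹(Bᵀ ζ)` is the
diagonal matrix of edge weights. -/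
noncomputable def xiMatrix (G : OrientedGraph V E) (cap : E → ℝ≥0∞) (cost : E → ℝ → EReal)
    (ζ : V → ℝ) : Matrix V V ℝ :=
  (G.treeMatrix (edgeWeight G cap cost ζ))ᵀ *
    Matrix.diagonal (fun k => (edgeWeight G cap cost ζ k)⁻¹) *
    G.incidenceᵀ * gramPinv G.incidence

/-- The projection `Q = I - (1/n) 1 1ᵀ`. -/
noncomputable def meanProj (V : Type*) [Fintype V] [DecidableEq V] : Matrix V V ℝ :=
  1 - (1 / (Fintype.card V : ℝ)) • Matrix.of fun _ _ => (1 : ℝ)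

/-- `Z(ζ, w) = B ∇𝒫⁻¹(Bᵀ ζ) + P w`. -/
noncomputable def flowResidual (G : OrientedGraph V E) (cap : E → ℝ≥0∞) (cost : E → ℝ → EReal)
    (P : Matrix V R ℝ) (ζ : V → ℝ) (w : R → ℝ) : V → ℝ :=
  G.incidence *ᵥ dualFlow G cap cost ζ + P *ᵥ w

/-- The pricing controller dynamics
`Φ(ζ, w, x) = -Q Ξ(ζ) (P s(w) + x + κ (B ∇𝒫⁻¹(Bᵀ ζ) + P w))`. -/
noncomputable def pricePhi (G : OrientedGraph V E) (cap : E → ℝ≥0∞) (cost : E → ℝ → EReal)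
    (P : Matrix V R ℝ) (s : (R → ℝ) → (R → ℝ)) (κ : ℝ)
    (ζ : V → ℝ) (w : R → ℝ) (x : V → ℝ) : V → ℝ :=
  -((meanProj V * xiMatrix G cap cost ζ) *ᵥ
    (P *ᵥ s w + x + κ • flowResidual G cap cost P ζ w))

/-- The pricing controller output `Ψ(ζ, x) = ∇𝒫⁻¹(Bᵀ ζ) - Bᵀ x`. -/
noncomputable def pricePsi (G : OrientedGraph V E) (cap : E → ℝ≥0∞) (cost : E → ℝ → EReal)
    (ζ x : V → ℝ) : E → ℝ :=
  dualFlow G cap cost ζ - G.incidenceᵀ *ᵥ x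

/-- The time interval `[0, τ)`, with `τ ≤ ∞`. -/
def horizon (τ : EReal) : Set ℝ := {t | 0 ≤ t ∧ (t : EReal) < τ}

/-- `w` solves the exosystem `ẇ = s(w)` on `[0, τ)`. -/
def IsExoSolution (s : (R → ℝ) → (R → ℝ)) (τ : EReal) (w : ℝ → R → ℝ) : Prop :=
  ∀ t ∈ horizon τ, HasDerivWithinAt w (s (w t)) (horizon τ) t

/-- Every solution of the exosystem that starts in `W` stays in `W` as long as it exists. -/
def ForwardInvariant (s : (R → ℝ) → (R → ℝ)) (W : Set (R → ℝ)) : Prop :=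
  ∀ (τ : EReal) (w : ℝ → R → ℝ), IsExoSolution s τ w → w 0 ∈ W → ∀ t ∈ horizon τ, w t ∈ W

/-- `(x, w, ζ)` is a solution on `[0, τ)` of the closed loop formed by the inventory dynamics
`ẋ = B λ + P w`, the exosystem `ẇ = s(w)` and the controller `ζ̇ = Φ(ζ, w, x)`, `λ = Ψ(ζ, x)`,
with an admissible supply: it starts in `W` and is balanced. -/
structure IsClosedLoopSolution (G : OrientedGraph V E) (P : Matrix V R ℝ)
    (s : (R → ℝ) → (R → ℝ)) (W : Set (R → ℝ))
    (Φ : (V → ℝ) → (R → ℝ) → (V → ℝ) → (V → ℝ)) (Ψ : (V → ℝ) → (V → ℝ) → (E → ℝ))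
    (τ : EReal) (x : ℝ → V → ℝ) (w : ℝ → R → ℝ) (ζ : ℝ → V → ℝ) : Prop where
  inventory : ∀ t ∈ horizon τ,
    HasDerivWithinAt x (G.incidence *ᵥ Ψ (ζ t) (x t) + P *ᵥ w t) (horizon τ) t
  exo : IsExoSolution s τ w
  controller : ∀ t ∈ horizon τ, HasDerivWithinAt ζ (Φ (ζ t) (w t) (x t)) (horizon τ) t
  init_mem : w 0 ∈ W
  balanced : ∀ t ∈ horizon τ, ∑ i, (P *ᵥ w t) i = 0

/-- The set `Γ` of optimal routing/supply pairs: `∇𝒫(λ)` exists and lies in the range of `Bᵀ`,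
and `B λ + P w = 0`. -/
def optimalPairs (G : OrientedGraph V E) (cap : E → ℝ≥0∞) (cost : E → ℝ → EReal)
    (P : Matrix V R ℝ) (W : Set (R → ℝ)) : Set ((E → ℝ) × (R → ℝ)) :=
  {q | q.2 ∈ W ∧ (∀ k, q.1 k ∈ flowInterval (cap k)) ∧
    (∃ ζ : V → ℝ, (fun k => costGrad (cost k) (q.1 k)) = G.incidenceᵀ *ᵥ ζ) ∧
    G.incidence *ᵥ q.1 + P *ᵥ q.2 = 0}

/-- The Euclidean distance of `q` from the set `A` (infinite if `A` is empty). -/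
noncomputable def distTo (A : Set ((E → ℝ) × (R → ℝ))) (q : (E → ℝ) × (R → ℝ)) : ℝ≥0∞ :=
  ⨅ a ∈ A, ENNReal.ofReal
    (Real.sqrt (∑ k, (a.1 k - q.1 k) ^ 2 + ∑ j, (a.2 j - q.2 j) ^ 2))

/-- The controller `(Φ, Ψ)` solves the time-varying optimal distribution problem: every
closed-loop solution is bounded on its interval of existence `[0, τ)`, and if it exists for all
times, then the storage becomes balanced and the routing asymptotically optimal. -/
def SolvesOptimalDistribution (G : OrientedGraph V E) (cap : E → ℝ≥0∞) (cost : E → ℝ → EReal)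
    (P : Matrix V R ℝ) (s : (R → ℝ) → (R → ℝ)) (W : Set (R → ℝ))
    (Φ : (V → ℝ) → (R → ℝ) → (V → ℝ) → (V → ℝ)) (Ψ : (V → ℝ) → (V → ℝ) → (E → ℝ)) : Prop :=
  ∀ (τ : EReal) (x : ℝ → V → ℝ) (w : ℝ → R → ℝ) (ζ : ℝ → V → ℝ),
    IsClosedLoopSolution G P s W Φ Ψ τ x w ζ →
    (∃ C : ℝ, ∀ t ∈ horizon τ, ‖x t‖ ≤ C ∧ ‖w t‖ ≤ C ∧ ‖ζ t‖ ≤ C) ∧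
    (τ = ⊤ →
      Tendsto (fun t => G.incidenceᵀ *ᵥ x t) atTop (𝓝 0) ∧
      Tendsto (fun t => distTo (optimalPairs G cap cost P W) (Ψ (ζ t) (x t), w t))
        atTop (𝓝 0))

/-- The average `(1/n) 1ᵀ x` of a vector of inventory levels. -/
noncomputable def average (x : V → ℝ) : ℝ := (1 / (Fintype.card V : ℝ)) * ∑ i, x i

/-- The composite storage function `U(ξ, ζ, w) = ½ ‖ξ‖² + ½ ‖Z(ζ, w)‖²` (Euclidean norms). -/
noncomputable def storage (G : OrientedGraph V E) (cap : E → ℝ≥0∞) (cost : E → ℝ → EReal)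
    (P : Matrix V R ℝ) (ξ ζ : V → ℝ) (w : R → ℝ) : ℝ :=
  (1 / 2) * ∑ i, ξ i ^ 2 + (1 / 2) * ∑ i, flowResidual G cap cost P ζ w i ^ 2

/-- `min {s₂, κ}`, where `s₂` is the smallest non-zero eigenvalue of the Laplacian `B Bᵀ`
(just `κ` if there is none). -/
noncomputable def decayRate (G : OrientedGraph V E) (κ : ℝ) : ℝ :=
  sInf (insert κ {μ : ℝ | μ ≠ 0 ∧
    Module.End.HasEigenvalue (Matrix.toLin' (G.incidence * G.incidenceᵀ)) μ})

end Network

/-!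
# Exponential decay for the pricing controller

Write `ξ = x - average (x 0)` for the deviation of the inventory from balance, `L = B Bᵀ`, and
`Z(ζ, w) = B ∇𝒫⁻¹(Bᵀ ζ) + P w` for the residual. The total inventory is conserved, and substituting
the controller output into the inventory dynamics gives `ξ' = Z - L ξ`. On the other hand
`Z' = B H(ζ) Bᵀ ζ' + P s(w)`, so everything rests on the identity `B H Bᵀ Q Ξ(ζ) = L L†`, the
orthogonal projection onto the vectors of zero sum
(`weightedLaplacian_mul_xiMatrix_mulVec`). With it `Z' = -ξ - κ Z`, the cross terms in the
derivative of the storage function `U` cancel, and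
`U' = -ξᵀ L ξ - κ ‖Z‖² ≤ -2 σ U` by the Poincaré inequality on a connected graph
(`OrientedGraph.decayRate_mul_le`, `storage_le`).

The identity for `Ξ` follows from `B H Bᵀ Xᵀ = B H` (`OrientedGraph.treeMatrix_spec`), a weighted
form of Kirchhoff's theorem. It is proved by expanding each column of `B` in the columns of a
spanning tree and comparing the two resulting sums over pairs of a tree and an edge: exchanging a
tree edge for an edge of its fundamental cut is a bijection between the pairs and preserves the
weights and the signs (`OrientedGraph.IsSpanningTree.exchange`).

Boundedness of `x` and of the residual is immediate from the decay of `U`. The prices `ζ` have a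
constant mean, so only their differences matter. Since every cut has infinite capacity, the lines of
infinite capacity connect the graph, and on these the inverse gradient is unbounded in both
directions. A large price difference would therefore cause a power `∑ k, y k * q k (y k)`, with
`y = Bᵀ ζ` and `q k = ∇𝒫ₖ⁻¹`, larger than a bounded divergence allows
(`OrientedGraph.exists_bound_of_divergence`).

Finally `Bᵀ x = Bᵀ ξ → 0` and `Z → 0`. By compactness, every sequence of times tending to infinity
has a subsequence along which `(ζ, w)` converges; the limit has zero residual, hence yields a point
of `optimalPairs`, and the flows converge to it (`tendsto_distTo_optimalPairs`).
-/

/-! ### Spanning trees and fundamental cuts -/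

namespace OrientedGraph

variable {V E : Type*}

theorem sub_adj_of_mem (G : OrientedGraph V E) {F : Set E} {k : E} (hk : k ∈ F) :
    (G.sub F).Adj (G.src k) (G.tgt k) := by
  rw [sub, SimpleGraph.fromRel_adj]
  exact ⟨G.src_ne_tgt k, Or.inl ⟨k, hk, rfl, rfl⟩⟩

theorem exists_of_sub_adj (G : OrientedGraph V E) {F : Set E} {i j : V} (h : (G.sub F).Adj i j) :
    ∃ k ∈ F, (G.src k = i ∧ G.tgt k = j) ∨ (G.src k = j ∧ G.tgt k = i) := by
  rw [sub, SimpleGraph.fromRel_adj] at h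
  obtain ⟨-, ⟨k, hk, h⟩ | ⟨k, hk, h⟩⟩ := h
  · exact ⟨k, hk, Or.inl h⟩
  · exact ⟨k, hk, Or.inr h⟩

/-- A predicate that takes the same value at both ends of every edge of `F` is constant along the
components of `(V, F)`. -/
theorem reachable_induction (G : OrientedGraph V E) {F : Set E} (p : V → Prop)
    (hp : ∀ k ∈ F, p (G.src k) ↔ p (G.tgt k)) {i j : V} (hi : p i)
    (h : (G.sub F).Reachable i j) : p j := by
  rw [SimpleGraph.reachable_iff_reflTransGen] at h
  induction h with
  | refl => exact hi
  | tail _ hab ih =>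
    obtain ⟨k, hk, ⟨rfl, rfl⟩ | ⟨rfl, rfl⟩⟩ := G.exists_of_sub_adj hab
    · exact (hp k hk).1 ih
    · exact (hp k hk).2 ih

theorem reachable_src_iff_tgt (G : OrientedGraph V E) {F : Set E} {k : E} (hk : k ∈ F) (i : V) :
    (G.sub F).Reachable i (G.src k) ↔ (G.sub F).Reachable i (G.tgt k) :=
  ⟨fun h => h.trans (G.sub_adj_of_mem hk).reachable,
    fun h => h.trans (G.sub_adj_of_mem hk).symm.reachable⟩

theorem sub_mono (G : OrientedGraph V E) {F F' : Set E} (h : F ⊆ F') : G.sub F ≤ G.sub F' := by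
  intro i j hij
  obtain ⟨k, hk, ⟨rfl, rfl⟩ | ⟨rfl, rfl⟩⟩ := G.exists_of_sub_adj hij
  · exact G.sub_adj_of_mem (h hk)
  · exact (G.sub_adj_of_mem (h hk)).symm

theorem card_edgeSet_sub_le (G : OrientedGraph V E) (T : Finset E) :
    Nat.card (G.sub (T : Set E)).edgeSet ≤ T.card := by
  have h : (G.sub (T : Set E)).edgeSet ⊆ (fun k => s(G.src k, G.tgt k)) '' (T : Set E) := by
    intro e
    induction e with
    | h i j =>
      intro h
      obtain ⟨k, hk, ⟨rfl, rfl⟩ | ⟨rfl, rfl⟩⟩ := G.exists_of_sub_adj h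
      · exact ⟨k, hk, rfl⟩
      · exact ⟨k, hk, Sym2.eq_swap⟩
  calc Nat.card (G.sub (T : Set E)).edgeSet
      ≤ ((fun k => s(G.src k, G.tgt k)) '' (T : Set E)).ncard :=
        Set.ncard_le_ncard h (T.finite_toSet.image _)
    _ ≤ (T : Set E).ncard := Set.ncard_image_le T.finite_toSet
    _ = T.card := Set.ncard_coe_finset T

theorem card_le_of_connected [Fintype V] (G : OrientedGraph V E) {T : Finset E}
    (h : (G.sub (T : Set E)).Connected) : Fintype.card V ≤ T.card + 1 := by
  have h1 := h.card_vert_le_card_edgeSet_add_one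
  rw [Nat.card_eq_fintype_card] at h1
  exact h1.trans (Nat.add_le_add_right (G.card_edgeSet_sub_le T) 1)

theorem isSpanningTree_iff [Fintype V] (G : OrientedGraph V E) (T : Finset E) :
    G.IsSpanningTree T ↔
      (G.sub (T : Set E)).Connected ∧ T.card + 1 = Fintype.card V := by
  refine ⟨fun h => ⟨h.1.connected, h.2⟩, fun h => ⟨?_, h.2⟩⟩
  rw [SimpleGraph.isTree_iff_connected_and_card]
  refine ⟨h.1, le_antisymm ?_ h.1.card_vert_le_card_edgeSet_add_one⟩
  rw [Nat.card_eq_fintype_card (α := V), ← h.2]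
  exact Nat.add_le_add_right (G.card_edgeSet_sub_le T) 1

theorem exists_isSpanningTree [Fintype V] (G : OrientedGraph V E) {F : Set E}
    (h : (G.sub F).Connected) : ∃ T : Finset E, G.IsSpanningTree T := by
  classical
  obtain ⟨t, ht, htree⟩ := h.exists_isTree_le
  have hedge : ∀ e : t.edgeSet, ∃ k : E, s(G.src k, G.tgt k) = (e : Sym2 V) := by
    rintro ⟨e, he⟩
    induction e with
    | h i j =>
      obtain ⟨k, -, ⟨rfl, rfl⟩ | ⟨rfl, rfl⟩⟩ := G.exists_of_sub_adj (ht he)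
      · exact ⟨k, rfl⟩
      · exact ⟨k, Sym2.eq_swap⟩
  choose f hf using hedge
  have hinj : Function.Injective f := fun a b hab => Subtype.ext (by rw [← hf a, ← hf b, hab])
  refine ⟨Finset.univ.image f, (G.isSpanningTree_iff _).2 ⟨?_, ?_⟩⟩
  · refine htree.connected.mono fun i j hij => ?_
    have h1 := hf ⟨s(i, j), hij⟩
    have h2 : f ⟨s(i, j), hij⟩ ∈ ((Finset.univ.image f : Finset E) : Set E) := by simp
    rcases Sym2.eq_iff.1 h1 with ⟨h3, h4⟩ | ⟨h3, h4⟩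
    · have := G.sub_adj_of_mem h2
      rwa [h3, h4] at this
    · have := (G.sub_adj_of_mem h2).symm
      rwa [h3, h4] at this
  · rw [Finset.card_image_of_injective _ hinj, Finset.card_univ, ← Nat.card_eq_fintype_card,
      ← Nat.card_eq_fintype_card]
    exact (SimpleGraph.isTree_iff_connected_and_card.1 htree).2

theorem mem_positiveSide {G : OrientedGraph V E} {T : Finset E} {l : E} {i : V} :
    i ∈ G.positiveSide T l ↔ (G.sub ((T : Set E) \ {l})).Reachable (G.src l) i :=
  Iff.rfl

open Classical in
/-- The entry at `l` of the fundamental cut vector of `e` with respect to `T`: the difference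
across `l` of the indicator of the positive side of `e`. It is `1` or `-1` if `l` joins the two
components of `T \ {e}`, and `0` otherwise. -/
noncomputable def cutSign (G : OrientedGraph V E) (T : Finset E) (e l : E) : ℝ :=
  (if G.src l ∈ G.positiveSide T e then 1 else 0) -
    (if G.tgt l ∈ G.positiveSide T e then 1 else 0)

theorem cutSign_of_mem (G : OrientedGraph V E) {T : Finset E} {e f : E} (hf : f ∈ T)
    (hfe : f ≠ e) : G.cutSign T e f = 0 := by
  have hf' : f ∈ (T : Set E) \ {e} := ⟨hf, hfe⟩
  have h : G.src f ∈ G.positiveSide T e ↔ G.tgt f ∈ G.positiveSide T e :=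
    G.reachable_src_iff_tgt hf' _
  by_cases h' : G.tgt f ∈ G.positiveSide T e
  · rw [cutSign, if_pos h', if_pos (h.2 h'), sub_self]
  · rw [cutSign, if_neg h', if_neg (mt h.1 h'), sub_self]

theorem incidence_apply [DecidableEq V] (G : OrientedGraph V E) (i : V) (k : E) :
    G.incidence i k = (if G.src k = i then 1 else 0) - (if G.tgt k = i then 1 else 0) := by
  have := G.src_ne_tgt k
  rw [incidence, Matrix.of_apply]
  by_cases h : G.src k = i
  · have h' : G.tgt k ≠ i := fun h' => this (h.trans h'.symm)
    simp [h, h']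
  · by_cases h' : G.tgt k = i <;> simp [h, h']

theorem transpose_mulVec_apply [Fintype V] [DecidableEq V] (G : OrientedGraph V E) (u : V → ℝ)
    (k : E) : (G.incidenceᵀ *ᵥ u) k = u (G.src k) - u (G.tgt k) := by
  simp only [Matrix.mulVec, dotProduct, Matrix.transpose_apply, incidence_apply, sub_mul, ite_mul,
    one_mul, zero_mul, Finset.sum_sub_distrib]
  simp

theorem transpose_mulVec_sub_const [Fintype V] [DecidableEq V] (G : OrientedGraph V E)
    (u : V → ℝ) (a : ℝ) :
    (G.incidenceᵀ *ᵥ fun i => u i - a) = G.incidenceᵀ *ᵥ u := by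
  ext k
  rw [G.transpose_mulVec_apply, G.transpose_mulVec_apply, sub_sub_sub_cancel_right]

section Tree

variable [Fintype V] [DecidableEq E] {G : OrientedGraph V E} {T : Finset E} {e l : E}

/-- Every edge of a spanning tree is a bridge: deleting it without disconnecting the graph would
leave too few edges for connectedness. -/
theorem IsSpanningTree.not_reachable (hT : G.IsSpanningTree T)
    (he : e ∈ T) : ¬ (G.sub ((T : Set E) \ {e})).Reachable (G.src e) (G.tgt e) := by
  intro h
  obtain ⟨hc, hcard⟩ := (G.isSpanningTree_iff T).1 hT
  have hcon : (G.sub ((T.erase e : Finset E) : Set E)).Connected := by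
    have := hc.nonempty
    refine SimpleGraph.Connected.mk fun i j => ?_
    refine G.reachable_induction (fun j => (G.sub ((T.erase e : Finset E) : Set E)).Reachable i j)
      (fun k hk => ?_) (SimpleGraph.Reachable.refl i) (hc.preconnected i j)
    rw [Finset.coe_erase]
    by_cases hke : k = e
    · subst hke
      exact ⟨fun h' => h'.trans h, fun h' => h'.trans h.symm⟩
    · exact G.reachable_src_iff_tgt (by simpa using ⟨hk, hke⟩) i
  have h1 := G.card_le_of_connected hcon
  rw [Finset.card_erase_of_mem he] at h1
  have := Finset.card_pos.2 ⟨e, he⟩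
  omega

theorem IsSpanningTree.reachable_or (hT : G.IsSpanningTree T) (e : E)
    (i : V) : (G.sub ((T : Set E) \ {e})).Reachable (G.src e) i ∨
      (G.sub ((T : Set E) \ {e})).Reachable (G.tgt e) i := by
  have hc := ((G.isSpanningTree_iff T).1 hT).1
  refine G.reachable_induction (fun i => (G.sub ((T : Set E) \ {e})).Reachable (G.src e) i ∨
      (G.sub ((T : Set E) \ {e})).Reachable (G.tgt e) i) (fun k hk => ?_)
    (Or.inl (SimpleGraph.Reachable.refl _)) (hc.preconnected (G.src e) i)
  by_cases hke : k = e
  · subst hke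
    exact ⟨fun _ => Or.inr (SimpleGraph.Reachable.refl _),
      fun _ => Or.inl (SimpleGraph.Reachable.refl _)⟩
  · have hk' : k ∈ (T : Set E) \ {e} := ⟨hk, hke⟩
    rw [G.reachable_src_iff_tgt hk', G.reachable_src_iff_tgt hk']

theorem IsSpanningTree.cutSign_self (hT : G.IsSpanningTree T)
    (he : e ∈ T) : G.cutSign T e e = 1 := by
  have h := hT.not_reachable he
  simp [cutSign, mem_positiveSide, h]

/-- If `l` lies in the fundamental cut of `e` with respect to the spanning tree `T`, then
exchanging `e` for `l` gives a spanning tree again, and `e` lies in the fundamental cut of `l`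
with respect to the new tree, with the same sign. -/
theorem IsSpanningTree.exchange (hT : G.IsSpanningTree T) (he : e ∈ T)
    (hl : l ∉ T) (hs : G.cutSign T e l ≠ 0) :
    G.IsSpanningTree (insert l (T.erase e)) ∧
      G.cutSign (insert l (T.erase e)) l e = G.cutSign T e l := by
  have hsdiff : ((insert l (T.erase e) : Finset E) : Set E) \ {l} = (T : Set E) \ {e} := by
    rw [← Finset.coe_erase, ← Finset.coe_erase, Finset.erase_insert (by simp [hl])]
  have hne := hT.not_reachable he
  have hor := hT.reachable_or e
  have hc := ((G.isSpanningTree_iff T).1 hT).1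
  have hcard := hT.2
  have hside : ∀ i, i ∈ G.positiveSide (insert l (T.erase e)) l ↔
      (G.sub ((T : Set E) \ {e})).Reachable (G.src l) i := fun i => by
    rw [mem_positiveSide, hsdiff]
  have hside' : ∀ i, i ∈ G.positiveSide T e ↔
      (G.sub ((T : Set E) \ {e})).Reachable (G.src e) i := fun i => Iff.rfl
  set R := (G.sub ((T : Set E) \ {e})).Reachable with hR
  have hsymm : ∀ {i j}, R i j → R j i := fun h => h.symm
  have htrans : ∀ {i j k}, R i j → R j k → R i k := fun h h' => h.trans h'
  -- The edge `l` joins the two components of `T \ {e}`, in one of the two directions.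
  have hcross : (R (G.src e) (G.src l) ∧ R (G.tgt e) (G.tgt l)) ∨
      (R (G.src e) (G.tgt l) ∧ R (G.tgt e) (G.src l)) := by
    by_cases h1 : R (G.src e) (G.src l) <;> by_cases h2 : R (G.src e) (G.tgt l)
    · exact absurd (by
        rw [cutSign, if_pos ((hside' _).2 h1), if_pos ((hside' _).2 h2), sub_self]) hs
    · exact Or.inl ⟨h1, (hor _).resolve_left h2⟩
    · exact Or.inr ⟨h2, (hor _).resolve_left h1⟩
    · exact absurd (by
        rw [cutSign, if_neg (mt (hside' _).1 h1), if_neg (mt (hside' _).1 h2), sub_self]) hs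
  refine ⟨(G.isSpanningTree_iff _).2 ⟨?_, ?_⟩, ?_⟩
  · have hle : G.sub ((T : Set E) \ {e}) ≤ G.sub ((insert l (T.erase e) : Finset E) : Set E) := by
      rw [← hsdiff]
      exact G.sub_mono sdiff_subset
    have hlr : (G.sub ((insert l (T.erase e) : Finset E) : Set E)).Reachable
        (G.src l) (G.tgt l) :=
      (G.sub_adj_of_mem (by simp)).reachable
    have hst : (G.sub ((insert l (T.erase e) : Finset E) : Set E)).Reachable
        (G.src e) (G.tgt e) := by
      rcases hcross with ⟨h1, h2⟩ | ⟨h1, h2⟩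
      · exact (h1.mono hle).trans (hlr.trans (h2.mono hle).symm)
      · exact (h1.mono hle).trans (hlr.symm.trans (h2.mono hle).symm)
    have hall : ∀ i, (G.sub ((insert l (T.erase e) : Finset E) : Set E)).Reachable
        (G.src e) i := fun i =>
      (hor i).elim (fun h => h.mono hle) (fun h => hst.trans (h.mono hle))
    have := hc.nonempty
    exact SimpleGraph.Connected.mk fun i j => (hall i).symm.trans (hall j)
  · rw [Finset.card_insert_of_notMem (by simp [hl]), Finset.card_erase_of_mem he, ← hcard]
    have := Finset.card_pos.2 ⟨e, he⟩
    omega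
  · rcases hcross with ⟨h1, h2⟩ | ⟨h1, h2⟩
    · have h3 : ¬ R (G.src e) (G.tgt l) := fun h => hne (htrans h (hsymm h2))
      have h4 : ¬ R (G.src l) (G.tgt e) := fun h => hne (htrans h1 h)
      rw [cutSign, cutSign, if_pos ((hside' _).2 h1), if_neg (mt (hside' _).1 h3),
        if_pos ((hside _).2 (hsymm h1)), if_neg (mt (hside _).1 h4)]
    · have h3 : ¬ R (G.src e) (G.src l) := fun h => hne (htrans h (hsymm h2))
      rw [cutSign, cutSign, if_pos ((hside' _).2 h1), if_neg (mt (hside' _).1 h3),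
        if_pos ((hside _).2 (hsymm h2)), if_neg fun h => h3 (hsymm ((hside _).1 h))]

/-- Expansion of a column of the incidence matrix in the columns of a spanning tree `T`: the
indicators of the positive sides of the edges of `T` are the coordinates dual to these columns. -/
theorem IsSpanningTree.incidence_eq_sum [DecidableEq V] (hT : G.IsSpanningTree T) (e : E)
    (i : V) : G.incidence i e = ∑ f ∈ T, G.cutSign T f e * G.incidence i f := by
  classical
  let φ : V → ℝ := fun a => ∑ f ∈ T, (if a ∈ G.positiveSide T f then 1 else 0) * G.incidence i f
  have hkey : ∀ k ∈ T, φ (G.src k) - φ (G.tgt k) = G.incidence i k := by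
    intro k hk
    have : φ (G.src k) - φ (G.tgt k) = ∑ f ∈ T, G.cutSign T f k * G.incidence i f := by
      simp only [φ, ← Finset.sum_sub_distrib, ← sub_mul, cutSign]
    rw [this, Finset.sum_eq_single k, hT.cutSign_self hk, one_mul]
    · intro f _ hfk
      rw [G.cutSign_of_mem hk hfk.symm, zero_mul]
    · exact fun h => absurd hk h
  have hc := ((G.isSpanningTree_iff T).1 hT).1
  -- `φ` and the indicator of `i` have the same differences across the edges of `T`.
  have hconst : ∀ b, φ (G.src e) - φ b =
      (if G.src e = i then 1 else 0) - (if b = i then 1 else 0) := by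
    intro b
    refine G.reachable_induction (fun b => φ (G.src e) - φ b =
      (if G.src e = i then 1 else 0) - (if b = i then 1 else 0)) (fun k hk => ?_) (by simp)
      (hc.preconnected (G.src e) b)
    have h1 := hkey k hk
    rw [G.incidence_apply] at h1
    constructor <;> intro h <;> linarith
  rw [G.incidence_apply, ← hconst]
  simp only [φ, ← Finset.sum_sub_distrib, ← sub_mul, cutSign]

end Tree

theorem prod_exchange {E : Type*} [DecidableEq E] (h : E → ℝ) {T : Finset E} {e l : E}
    (he : e ∈ T) (hl : l ∉ T) :
    (∏ k ∈ insert l (T.erase e), h k) * h e = (∏ k ∈ T, h k) * h l := by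
  rw [Finset.prod_insert (by simp [hl]), ← Finset.mul_prod_erase T h he]
  ring

theorem totalTreeWeight_pos [Fintype V] [Fintype E] (G : OrientedGraph V E) {F : Set E}
    (hc : (G.sub F).Connected) {h : E → ℝ} (hh : ∀ k, 0 < h k) : 0 < G.totalTreeWeight h := by
  classical
  obtain ⟨T, hT⟩ := G.exists_isSpanningTree hc
  exact Finset.sum_pos (fun T _ => Finset.prod_pos fun k _ => hh k)
    ⟨T, Finset.mem_filter.2 ⟨Finset.mem_univ _, hT⟩⟩

section Kirchhoff

variable [Fintype V] [DecidableEq V] [Fintype E] [DecidableEq E] (G : OrientedGraph V E)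

open Classical in
/-- Kirchhoff's theorem in weighted form: the weighted sum, over the spanning trees containing `e`,
of the flows `h l * cutSign T e l` through the fundamental cuts of `e` has the same divergence as
`totalTreeWeight` times the flow `h e` on `e` alone. The trees containing `e` cancel against the
terms `l = e`; for the others the column of `e` is expanded in the tree, and exchanging `e` for an
edge of its fundamental cut matches the terms. -/
theorem sum_tree_cut (h : E → ℝ) (i : V) (e : E) :
    ∑ l, G.incidence i l * h l *
        ∑ T : Finset E with G.IsSpanningTree T ∧ e ∈ T, (∏ k ∈ T, h k) * G.cutSign T e l =
      G.totalTreeWeight h * (G.incidence i e * h e) := by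
  have hR : G.totalTreeWeight h * (G.incidence i e * h e) =
      ∑ T : Finset E with G.IsSpanningTree T ∧ e ∈ T, (∏ k ∈ T, h k) * (G.incidence i e * h e) +
      ∑ T : Finset E with G.IsSpanningTree T ∧ e ∉ T, (∏ k ∈ T, h k) * (G.incidence i e * h e) := by
    rw [totalTreeWeight, Finset.sum_mul,
      ← Finset.sum_filter_add_sum_filter_not _ (fun T : Finset E => e ∈ T), Finset.filter_filter,
      Finset.filter_filter]
  have hL : ∑ l, G.incidence i l * h l *
        ∑ T : Finset E with G.IsSpanningTree T ∧ e ∈ T, (∏ k ∈ T, h k) * G.cutSign T e l =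
      ∑ T : Finset E with G.IsSpanningTree T ∧ e ∈ T, ((∏ k ∈ T, h k) * (G.incidence i e * h e) +
        ∑ l with l ∉ T, G.incidence i l * h l * ((∏ k ∈ T, h k) * G.cutSign T e l)) := by
    simp only [Finset.mul_sum]
    rw [Finset.sum_comm]
    refine Finset.sum_congr rfl fun T hT => ?_
    obtain ⟨hT, he⟩ := (Finset.mem_filter.1 hT).2
    rw [← Finset.sum_filter_add_sum_filter_not _ (fun l : E => l ∈ T), Finset.sum_eq_single e]
    · rw [hT.cutSign_self he]
      ring
    · intro l hl hle
      rw [G.cutSign_of_mem (Finset.mem_filter.1 hl).2 hle]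
      ring
    · intro h'
      exact absurd (Finset.mem_filter.2 ⟨Finset.mem_univ _, he⟩) h'
  have hE : ∑ T : Finset E with G.IsSpanningTree T ∧ e ∉ T,
        (∏ k ∈ T, h k) * (G.incidence i e * h e) =
      ∑ T : Finset E with G.IsSpanningTree T ∧ e ∉ T, ∑ f ∈ T,
        (∏ k ∈ T, h k) * h e * (G.cutSign T f e * G.incidence i f) := by
    refine Finset.sum_congr rfl fun T hT => ?_
    rw [(Finset.mem_filter.1 hT).2.1.incidence_eq_sum e i, Finset.sum_mul, Finset.mul_sum]
    exact Finset.sum_congr rfl fun f _ => by ring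
  rw [hL, hR, Finset.sum_add_distrib, add_right_inj, hE, Finset.sum_sigma', Finset.sum_sigma']
  refine Finset.sum_bij_ne_zero (fun p _ _ => ⟨insert p.2 (p.1.erase e), p.2⟩) ?_ ?_ ?_ ?_
  · rintro ⟨T, l⟩ hp hne
    simp only [Finset.mem_sigma, Finset.mem_filter, Finset.mem_univ, true_and] at hp ⊢
    obtain ⟨⟨hT, he⟩, hl⟩ := hp
    have hs : G.cutSign T e l ≠ 0 := fun h0 => hne (by simp [h0])
    have hel : e ≠ l := fun h => hl (h ▸ he)
    exact ⟨⟨(hT.exchange he hl hs).1, by simp [hel]⟩, by simp⟩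
  · rintro ⟨T, l⟩ hp _ ⟨T', l'⟩ hp' _ heq
    simp only [Finset.mem_sigma, Finset.mem_filter, Finset.mem_univ, true_and] at hp hp'
    simp only [Sigma.mk.injEq, heq_eq_eq] at heq
    obtain ⟨heq, rfl⟩ := heq
    have h1 : T.erase e = T'.erase e := by
      have := congrArg (fun S : Finset E => S.erase l) heq
      simpa [Finset.erase_insert, hp.2, hp'.2] using this
    have h2 : T = T' := by
      rw [← Finset.insert_erase hp.1.2, h1, Finset.insert_erase hp'.1.2]
    rw [h2]
  · rintro ⟨T, f⟩ hp hne
    simp only [Finset.mem_sigma, Finset.mem_filter, Finset.mem_univ, true_and] at hp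
    obtain ⟨⟨hT, he⟩, hf⟩ := hp
    have hs : G.cutSign T f e ≠ 0 := fun h0 => hne (by simp [h0])
    have hfe : f ≠ e := fun h => he (h ▸ hf)
    obtain ⟨hT', hsign⟩ := hT.exchange hf he hs
    refine ⟨⟨insert e (T.erase f), f⟩, ?_, ?_, ?_⟩
    · simp only [Finset.mem_sigma, Finset.mem_filter, Finset.mem_univ, true_and]
      exact ⟨⟨hT', by simp⟩, by simp [hfe]⟩
    · have hprod := prod_exchange h hf he
      rw [hsign]
      intro h0
      apply hne
      linear_combination h0 - G.cutSign T f e * G.incidence i f * hprod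
    · simp [he, Finset.insert_erase hf]
  · rintro ⟨T, l⟩ hp hne
    simp only [Finset.mem_sigma, Finset.mem_filter, Finset.mem_univ, true_and] at hp
    obtain ⟨⟨hT, he⟩, hl⟩ := hp
    have hs : G.cutSign T e l ≠ 0 := fun h0 => hne (by simp [h0])
    rw [(hT.exchange he hl hs).2]
    linear_combination -(G.cutSign T e l * G.incidence i l) * (prod_exchange h he hl)

/-- `B H Bᵀ Xᵀ = B H`: the matrix `Bᵀ Xᵀ` is the `H`-orthogonal projection onto the range of
`Bᵀ`. -/
theorem treeMatrix_spec {F : Set E} (hc : (G.sub F).Connected) {h : E → ℝ}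
    (hh : ∀ k, 0 < h k) :
    G.incidence * Matrix.diagonal h * G.incidenceᵀ * (G.treeMatrix h)ᵀ =
      G.incidence * Matrix.diagonal h := by
  classical
  have hw := (G.totalTreeWeight_pos hc hh).ne'
  ext i e
  have hcut : ∀ l, (G.incidenceᵀ * (G.treeMatrix h)ᵀ) l e = (1 / G.totalTreeWeight h) *
      ∑ T : Finset E with G.IsSpanningTree T ∧ e ∈ T, (∏ k ∈ T, h k) * G.cutSign T e l := by
    intro l
    have h1 : (G.incidenceᵀ * (G.treeMatrix h)ᵀ) l e =
        (G.incidenceᵀ *ᵥ fun j => G.treeMatrix h e j) l := rfl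
    have h2 : ∀ j, G.treeMatrix h e j = (1 / G.totalTreeWeight h) *
        ∑ T : Finset E with G.IsSpanningTree T ∧ e ∈ T,
          (∏ k ∈ T, h k) * (if j ∈ G.positiveSide T e then 1 else 0) := by
      intro j
      simp only [mul_ite, mul_one, mul_zero, ← Finset.sum_filter, Finset.filter_filter, treeMatrix,
        Matrix.of_apply, and_assoc]
      congr!
    rw [h1, transpose_mulVec_apply, h2, h2, ← mul_sub, ← Finset.sum_sub_distrib]
    simp only [cutSign, mul_sub]
  rw [Matrix.mul_assoc, Matrix.mul_apply]
  simp only [Matrix.mul_diagonal, hcut]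
  have h3 := G.sum_tree_cut h i e
  calc ∑ l, G.incidence i l * h l * (1 / G.totalTreeWeight h *
        ∑ T : Finset E with G.IsSpanningTree T ∧ e ∈ T, (∏ k ∈ T, h k) * G.cutSign T e l)
      = (1 / G.totalTreeWeight h) * ∑ l, G.incidence i l * h l *
        ∑ T : Finset E with G.IsSpanningTree T ∧ e ∈ T, (∏ k ∈ T, h k) * G.cutSign T e l := by
        rw [Finset.mul_sum]
        exact Finset.sum_congr rfl fun l _ => by ring
    _ = G.incidence i e * h e := by
        rw [h3]
        field_simp

end Kirchhoff

end OrientedGraph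

/-! ### The inverse gradient of a Legendre cost -/

theorem mem_flowInterval_of_abs_le {c : ℝ≥0∞} {s t : ℝ} (ht : t ∈ flowInterval c)
    (h : |s| ≤ |t|) : s ∈ flowInterval c :=
  (ENNReal.ofReal_le_ofReal h).trans_lt ht

theorem isOpen_flowInterval (c : ℝ≥0∞) : IsOpen (flowInterval c) :=
  isOpen_Iio.preimage (ENNReal.continuous_ofReal.comp continuous_abs)

theorem ordConnected_flowInterval (c : ℝ≥0∞) : (flowInterval c).OrdConnected := by
  refine ⟨fun a ha b hb t ht => ?_⟩
  have h : |t| ≤ max |a| |b| := abs_le_max_abs_abs ht.1 ht.2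
  rcases le_max_iff.1 h with h | h
  · exact mem_flowInterval_of_abs_le ha h
  · exact mem_flowInterval_of_abs_le hb h

theorem zero_mem_flowInterval {c : ℝ≥0∞} (hc : 0 < c) : (0 : ℝ) ∈ flowInterval c := by
  simpa [flowInterval] using hc

namespace IsLegendreCost

variable {c : ℝ≥0∞} {p : ℝ → EReal}

theorem hasDerivAt_costGrad (hp : IsLegendreCost c p) {s : ℝ} (hs : s ∈ flowInterval c) :
    HasDerivAt (costGrad p) (deriv (costGrad p) s) s :=
  (differentiableAt_of_deriv_ne_zero (hp.hess_pos s hs).ne').hasDerivAt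

theorem continuousOn_costGrad (hp : IsLegendreCost c p) :
    ContinuousOn (costGrad p) (flowInterval c) := fun _ hs =>
  (hp.hasDerivAt_costGrad hs).continuousAt.continuousWithinAt

theorem strictMonoOn_costGrad (hp : IsLegendreCost c p) :
    StrictMonoOn (costGrad p) (flowInterval c) :=
  strictMonoOn_of_deriv_pos (ordConnected_flowInterval c).convex hp.continuousOn_costGrad
    fun s hs => hp.hess_pos s (interior_subset hs)

theorem exists_tendsto_capacity (hc : 0 < c) : ∃ u : ℕ → ℝ, (∀ l, 0 < u l ∧ u l ∈ flowInterval c) ∧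
    Tendsto (fun l => ENNReal.ofReal |u l|) atTop (𝓝 c) := by
  obtain ⟨v, -, hv, hlim⟩ := exists_seq_strictMono_tendsto' hc
  have hval : ∀ l, ENNReal.ofReal |(v l).toReal| = v l := fun l => by
    rw [abs_of_nonneg ENNReal.toReal_nonneg, ENNReal.ofReal_toReal (hv l).2.ne_top]
  refine ⟨fun l => (v l).toReal, fun l => ⟨ENNReal.toReal_pos (hv l).1.ne' (hv l).2.ne_top, ?_⟩, ?_⟩
  · simpa only [flowInterval, mem_ofPred_eq, hval] using (hv l).2
  · simpa only [hval] using hlim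

/-- The gradient maps the open flow interval onto `ℝ`: by monotonicity it is bounded below on the
positive flows and above on the negative ones, so its blow-up at the capacity has a sign. -/
theorem surjOn_costGrad (hp : IsLegendreCost c p) (hc : 0 < c) :
    SurjOn (costGrad p) (flowInterval c) univ := by
  intro y _
  obtain ⟨u, hu, hlim⟩ := exists_tendsto_capacity hc
  have h0 := zero_mem_flowInterval hc
  have hneg : ∀ l, -u l ∈ flowInterval c := fun l =>
    mem_flowInterval_of_abs_le (hu l).2 (abs_neg _).le
  have hup := hp.grad_blowup u (fun l => (hu l).2) hlim
  have hdown := hp.grad_blowup (fun l => -u l) hneg (by simpa only [abs_neg] using hlim)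
  obtain ⟨a, ha⟩ := (hup.eventually_gt_atTop (max |y| |costGrad p 0|)).exists
  obtain ⟨b, hb⟩ := (hdown.eventually_gt_atTop (max |y| |costGrad p 0|)).exists
  obtain ⟨ha1, ha2⟩ := max_lt_iff.1 ha
  obtain ⟨hb1, hb2⟩ := max_lt_iff.1 hb
  have hga := hp.strictMonoOn_costGrad h0 (hu a).2 (hu a).1
  have hgb := hp.strictMonoOn_costGrad (hneg b) h0 (neg_lt_zero.2 (hu b).1)
  have hya : y ≤ costGrad p (u a) := by
    rcases lt_abs.1 ha2 with h | h
    · rcases lt_abs.1 ha1 with h' | h'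
      · exact (le_abs_self y).trans h'.le
      · linarith [abs_nonneg (costGrad p 0), abs_nonneg y]
    · linarith [neg_abs_le (costGrad p 0)]
  have hyb : costGrad p (-u b) ≤ y := by
    rcases lt_abs.1 hb2 with h | h
    · linarith [le_abs_self (costGrad p 0)]
    · rcases lt_abs.1 hb1 with h' | h'
      · linarith [abs_nonneg (costGrad p 0), abs_nonneg y]
      · linarith [neg_abs_le y]
  have hsub : Icc (-u b) (u a) ⊆ flowInterval c :=
    (ordConnected_flowInterval c).out (hneg b) (hu a).2
  have hle : -u b ≤ u a := by linarith [(hu a).1, (hu b).1]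
  obtain ⟨t, ht, rfl⟩ := intermediate_value_Icc hle (hp.continuousOn_costGrad.mono hsub) ⟨hyb, hya⟩
  exact ⟨t, hsub ht, rfl⟩

theorem gradInv_mem (hp : IsLegendreCost c p) (hc : 0 < c) (y : ℝ) :
    gradInv c p y ∈ flowInterval c :=
  Function.invFunOn_mem (hp.surjOn_costGrad hc (mem_univ y))

theorem costGrad_gradInv (hp : IsLegendreCost c p) (hc : 0 < c) (y : ℝ) :
    costGrad p (gradInv c p y) = y :=
  Function.invFunOn_eq (hp.surjOn_costGrad hc (mem_univ y))

theorem gradInv_costGrad (hp : IsLegendreCost c p) (hc : 0 < c) {s : ℝ}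
    (hs : s ∈ flowInterval c) : gradInv c p (costGrad p s) = s :=
  hp.strictMonoOn_costGrad.injOn (hp.gradInv_mem hc _) hs (hp.costGrad_gradInv hc _)

theorem monotone_gradInv (hp : IsLegendreCost c p) (hc : 0 < c) : Monotone (gradInv c p) := by
  intro a b hab
  rw [← hp.strictMonoOn_costGrad.le_iff_le (hp.gradInv_mem hc a) (hp.gradInv_mem hc b),
    hp.costGrad_gradInv hc, hp.costGrad_gradInv hc]
  exact hab

theorem continuous_gradInv (hp : IsLegendreCost c p) (hc : 0 < c) : Continuous (gradInv c p) := by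
  refine continuous_iff_continuousAt.2 fun y =>
    continuousAt_of_monotoneOn_of_image_mem_nhds (s := univ)
      ((hp.monotone_gradInv hc).monotoneOn _) univ_mem ?_
  refine mem_of_superset ((isOpen_flowInterval c).mem_nhds (hp.gradInv_mem hc y)) fun s hs => ?_
  exact ⟨costGrad p s, mem_univ _, hp.gradInv_costGrad hc hs⟩

theorem hasDerivAt_gradInv_aux (hp : IsLegendreCost c p) (hc : 0 < c) (y : ℝ) :
    HasDerivAt (gradInv c p) (deriv (costGrad p) (gradInv c p y))⁻¹ y :=
  HasDerivAt.of_local_left_inverse (hp.continuous_gradInv hc).continuousAt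
    (hp.hasDerivAt_costGrad (hp.gradInv_mem hc y)) (hp.hess_pos _ (hp.gradInv_mem hc y)).ne'
    (Eventually.of_forall fun z => hp.costGrad_gradInv hc z)

theorem deriv_gradInv_pos (hp : IsLegendreCost c p) (hc : 0 < c) (y : ℝ) :
    0 < deriv (gradInv c p) y := by
  rw [(hp.hasDerivAt_gradInv_aux hc y).deriv]
  exact inv_pos.2 (hp.hess_pos _ (hp.gradInv_mem hc y))

theorem hasDerivAt_gradInv (hp : IsLegendreCost c p) (hc : 0 < c) (y : ℝ) :
    HasDerivAt (gradInv c p) (deriv (gradInv c p) y) y :=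
  (hp.hasDerivAt_gradInv_aux hc y).differentiableAt.hasDerivAt

theorem tendsto_gradInv_atTop (hp : IsLegendreCost ⊤ p) :
    Tendsto (gradInv ⊤ p) atTop atTop := by
  refine tendsto_atTop_atTop_of_monotone (hp.monotone_gradInv ENNReal.zero_lt_top) fun b => ?_
  exact ⟨costGrad p b,
    (hp.gradInv_costGrad ENNReal.zero_lt_top (by simp [flowInterval])).ge⟩

theorem tendsto_gradInv_atBot (hp : IsLegendreCost ⊤ p) :
    Tendsto (gradInv ⊤ p) atBot atBot := by
  refine tendsto_atBot_atBot_of_monotone (hp.monotone_gradInv ENNReal.zero_lt_top) fun b => ?_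
  exact ⟨costGrad p b,
    (hp.gradInv_costGrad ENNReal.zero_lt_top (by simp [flowInterval])).le⟩

end IsLegendreCost

/-! ### The Laplacian of a connected graph -/

namespace OrientedGraph

variable {V E : Type*}

/-- If every cut has infinite capacity, then the lines of infinite capacity connect the graph. -/
theorem preconnected_of_cutCapacity [Fintype E] (G : OrientedGraph V E) {cap : E → ℝ≥0∞}
    (hcut : ∀ S : Set V, S.Nonempty → S ≠ Set.univ → G.cutCapacity cap S = ⊤) :
    (G.sub {k | cap k = ⊤}).Preconnected := by
  classical
  intro i j
  by_contra hij
  have h := hcut {j | (G.sub {k | cap k = ⊤}).Reachable i j} ⟨i, SimpleGraph.Reachable.refl i⟩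
    fun h => hij (by
      have : j ∈ {j | (G.sub {k | cap k = ⊤}).Reachable i j} := h ▸ mem_univ j
      exact this)
  obtain ⟨k, hk, hcap⟩ := ENNReal.sum_eq_top.1 h
  have hst : (G.sub {k | cap k = ⊤}).Reachable i (G.src k) ↔
      (G.sub {k | cap k = ⊤}).Reachable i (G.tgt k) := G.reachable_src_iff_tgt hcap i
  rcases (Finset.mem_filter.1 hk).2 with ⟨h1, h2⟩ | ⟨h1, h2⟩
  · exact h2 (hst.1 h1)
  · exact h2 (hst.2 h1)

theorem abs_sub_le_of_preconnected [Fintype V] (G : OrientedGraph V E) {F : Set E}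
    (hF : (G.sub F).Preconnected) {u : V → ℝ} {a : ℝ} (ha : 0 ≤ a)
    (h : ∀ k ∈ F, |u (G.src k) - u (G.tgt k)| ≤ a) (i j : V) :
    |u i - u j| ≤ Fintype.card V * a := by
  have hwalk : ∀ {i j : V} (p : (G.sub F).Walk i j), |u i - u j| ≤ p.length * a := by
    intro i j p
    induction p with
    | nil => simp
    | @cons i l j hil p ih =>
      have h1 : |u i - u l| ≤ a := by
        obtain ⟨k, hk, ⟨rfl, rfl⟩ | ⟨rfl, rfl⟩⟩ := G.exists_of_sub_adj hil
        · exact h k hk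
        · rw [abs_sub_comm]
          exact h k hk
      calc |u i - u j| ≤ |u i - u l| + |u l - u j| := abs_sub_le _ _ _
        _ ≤ a + p.length * a := add_le_add h1 ih
        _ = (SimpleGraph.Walk.cons hil p).length * a := by
          rw [SimpleGraph.Walk.length_cons]
          push_cast
          ring
  obtain ⟨p, hp⟩ := (hF i j).exists_isPath
  exact (hwalk p).trans (mul_le_mul_of_nonneg_right (by exact_mod_cast hp.length_lt.le) ha)

section Laplacian

variable [Fintype V] [DecidableEq V] [Fintype E] (G : OrientedGraph V E)

theorem dotProduct_incidence_mulVec (u : V → ℝ) (f : E → ℝ) :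
    u ⬝ᵥ (G.incidence *ᵥ f) = ∑ k, (u (G.src k) - u (G.tgt k)) * f k := by
  rw [Matrix.dotProduct_mulVec, ← Matrix.mulVec_transpose]
  simp only [dotProduct, transpose_mulVec_apply]

theorem sum_incidence_mulVec (f : E → ℝ) : ∑ i, (G.incidence *ᵥ f) i = 0 := by
  have h := G.dotProduct_incidence_mulVec (fun _ => 1) f
  simpa [dotProduct] using h

theorem dotProduct_laplacian_mulVec (u : V → ℝ) :
    u ⬝ᵥ ((G.incidence * G.incidenceᵀ) *ᵥ u) = ∑ k, (u (G.src k) - u (G.tgt k)) ^ 2 := by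
  rw [← Matrix.mulVec_mulVec, dotProduct_incidence_mulVec]
  simp only [transpose_mulVec_apply, sq]

theorem eq_of_laplacian_mulVec_eq_zero {F : Set E} (hF : (G.sub F).Preconnected) {u : V → ℝ}
    (hu : (G.incidence * G.incidenceᵀ) *ᵥ u = 0) (i j : V) : u i = u j := by
  have h := G.dotProduct_laplacian_mulVec u
  rw [hu, dotProduct_zero, eq_comm, Finset.sum_eq_zero_iff_of_nonneg fun k _ => sq_nonneg _] at h
  refine G.reachable_induction (fun j => u i = u j) (fun k _ => ?_) rfl (hF i j)
  have hk : u (G.src k) = u (G.tgt k) := sub_eq_zero.1 (pow_eq_zero_iff two_ne_zero |>.1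
    (h k (Finset.mem_univ k)))
  rw [hk]

theorem laplacian_mulVec_const (a : ℝ) :
    (G.incidence * G.incidenceᵀ) *ᵥ (fun _ => a) = 0 := by
  have h : G.incidenceᵀ *ᵥ (fun _ => a) = 0 := by
    ext k
    rw [transpose_mulVec_apply, sub_self, Pi.zero_apply]
  rw [← Matrix.mulVec_mulVec, h, Matrix.mulVec_zero]

/-- For a connected graph `B Bᵀ (B Bᵀ)†` is the orthogonal projection onto the vectors of zero
sum. -/
theorem laplacian_mul_gramPinv_mulVec {F : Set E} (hF : (G.sub F).Preconnected) {v : V → ℝ}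
    (hv : ∑ i, v i = 0) : (G.incidence * G.incidenceᵀ * gramPinv G.incidence) *ᵥ v = v := by
  rcases isEmpty_or_nonempty V with hV | hV
  · exact Subsingleton.elim _ _
  have hspec := gramPinv_spec G.incidence
  have hLLM : (G.incidence * G.incidenceᵀ) * (G.incidence * G.incidenceᵀ * gramPinv G.incidence) =
      G.incidence * G.incidenceᵀ := by
    have h := congrArg Matrix.transpose hspec.mul_mul_left
    rwa [Matrix.transpose_mul, hspec.symm_left, transpose_mul_transpose_self] at h
  have hker : (G.incidence * G.incidenceᵀ) *ᵥ
      (v - (G.incidence * G.incidenceᵀ * gramPinv G.incidence) *ᵥ v) = 0 := by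
    rw [Matrix.mulVec_sub, Matrix.mulVec_mulVec, hLLM, sub_self]
  have hconst := G.eq_of_laplacian_mulVec_eq_zero hF hker
  set u := v - (G.incidence * G.incidenceᵀ * gramPinv G.incidence) *ᵥ v with hu
  have hsum : ∑ i, u i = 0 := by
    rw [hu]
    simp only [Pi.sub_apply, Finset.sum_sub_distrib, hv]
    rw [Matrix.mul_assoc, ← Matrix.mulVec_mulVec, sum_incidence_mulVec, sub_zero]
  have hzero : ∀ i, u i = 0 := by
    intro i
    rw [Finset.sum_congr rfl fun j _ => hconst j i, Finset.sum_const, Finset.card_univ,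
      nsmul_eq_mul] at hsum
    exact (mul_eq_zero.1 hsum).resolve_left (by exact_mod_cast Fintype.card_ne_zero)
  have : u = 0 := funext hzero
  rw [hu, sub_eq_zero] at this
  exact this.symm

theorem laplacian_mul_gramPinv_mulVec_const (a : ℝ) :
    (G.incidence * G.incidenceᵀ * gramPinv G.incidence) *ᵥ (fun _ => a) = 0 := by
  rw [← (gramPinv_spec G.incidence).symm_left, Matrix.transpose_mul, transpose_mul_transpose_self,
    ← Matrix.mulVec_mulVec, laplacian_mulVec_const, Matrix.mulVec_zero]

theorem nonneg_of_hasEigenvalue {μ : ℝ}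
    (hμ : Module.End.HasEigenvalue (Matrix.toLin' (G.incidence * G.incidenceᵀ)) μ) : 0 ≤ μ := by
  obtain ⟨v, hv⟩ := hμ.exists_hasEigenvector
  have h1 : (G.incidence * G.incidenceᵀ) *ᵥ v = μ • v := by
    rw [← Matrix.toLin'_apply]
    exact hv.apply_eq_smul
  have h2 := G.dotProduct_laplacian_mulVec v
  rw [h1, dotProduct_smul, smul_eq_mul] at h2
  have h3 : 0 < v ⬝ᵥ v := by
    have : 0 ≤ v ⬝ᵥ v := Finset.sum_nonneg fun i _ => mul_self_nonneg _
    exact this.lt_of_ne' fun h => hv.2 (dotProduct_self_eq_zero.1 h)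
  refine nonneg_of_mul_nonneg_left ?_ h3
  rw [h2]
  exact Finset.sum_nonneg fun k _ => sq_nonneg _

theorem decayRate_pos {κ : ℝ} (hκ : 0 < κ) : 0 < decayRate G κ := by
  have hfin : (insert κ {μ : ℝ | μ ≠ 0 ∧ Module.End.HasEigenvalue
      (Matrix.toLin' (G.incidence * G.incidenceᵀ)) μ}).Finite :=
    ((Module.End.finite_hasEigenvalue _).subset fun μ hμ => hμ.2).insert κ
  have hmem := (insert_nonempty κ _).csInf_mem hfin
  rcases hmem with h | ⟨h1, h2⟩
  · rw [decayRate, h]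
    exact hκ
  · exact (G.nonneg_of_hasEigenvalue h2).lt_of_ne' h1

theorem decayRate_bddBelow {κ : ℝ} (hκ : 0 < κ) : BddBelow (insert κ {μ : ℝ | μ ≠ 0 ∧
    Module.End.HasEigenvalue (Matrix.toLin' (G.incidence * G.incidenceᵀ)) μ}) := by
  refine ⟨0, ?_⟩
  rintro μ (rfl | ⟨-, h⟩)
  · exact hκ.le
  · exact G.nonneg_of_hasEigenvalue h

theorem decayRate_le {κ : ℝ} (hκ : 0 < κ) : decayRate G κ ≤ κ :=
  csInf_le (G.decayRate_bddBelow hκ) (mem_insert _ _)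

/-- Poincaré inequality: vectors of zero sum are orthogonal to the kernel of the Laplacian, so on
them its quadratic form dominates the smallest non-zero eigenvalue. -/
theorem decayRate_mul_le {F : Set E} (hF : (G.sub F).Preconnected) {κ : ℝ} (hκ : 0 < κ)
    {ξ : V → ℝ} (hξ : ∑ i, ξ i = 0) :
    decayRate G κ * ∑ i, ξ i ^ 2 ≤ ξ ⬝ᵥ ((G.incidence * G.incidenceᵀ) *ᵥ ξ) := by
  have hL : (G.incidence * G.incidenceᵀ).IsHermitian := by
    rw [Matrix.IsHermitian, Matrix.conjTranspose_eq_transpose_of_trivial,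
      transpose_mul_transpose_self]
  set b := hL.eigenvectorBasis with hb
  have hev : ∀ j, Module.End.HasEigenvalue (Matrix.toLin' (G.incidence * G.incidenceᵀ))
      (hL.eigenvalues j) := fun j => by
    refine Module.End.hasEigenvalue_of_hasEigenvector (x := (b j).ofLp) ⟨?_, ?_⟩
    · rw [Module.End.mem_eigenspace_iff, Matrix.toLin'_apply]
      exact hL.mulVec_eigenvectorBasis j
    · intro h
      have h1 : b j = 0 := by
        ext i
        exact congrFun h i
      have := b.orthonormal.1 j
      rw [h1, norm_zero] at this
      exact zero_ne_one this
  let x : EuclideanSpace ℝ V := WithLp.toLp 2 ξ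
  let y : EuclideanSpace ℝ V := WithLp.toLp 2 ((G.incidence * G.incidenceᵀ) *ᵥ ξ)
  have hinner : ∀ (j : V) (u : V → ℝ), inner ℝ (b j) (WithLp.toLp 2 u) = u ⬝ᵥ (b j).ofLp := by
    intro j u
    simp [EuclideanSpace.inner_eq_star_dotProduct]
  have hy : ∀ j, inner ℝ (b j) y = hL.eigenvalues j * inner ℝ (b j) x := by
    intro j
    rw [hinner, hinner, dotProduct_comm, Matrix.dotProduct_mulVec, ← Matrix.mulVec_transpose,
      transpose_mul_transpose_self, hL.mulVec_eigenvectorBasis j, smul_dotProduct, smul_eq_mul,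
      dotProduct_comm]
  have hsq : ∑ j, inner ℝ (b j) x ^ 2 = ∑ i, ξ i ^ 2 := by
    rw [b.sum_sq_inner_right, EuclideanSpace.norm_sq_eq]
    simp [x]
  have hquad : ∑ j, hL.eigenvalues j * inner ℝ (b j) x ^ 2 =
      ξ ⬝ᵥ ((G.incidence * G.incidenceᵀ) *ᵥ ξ) := by
    have h := b.sum_inner_mul_inner x y
    have h2 : inner ℝ x y = ξ ⬝ᵥ ((G.incidence * G.incidenceᵀ) *ᵥ ξ) := by
      simp [EuclideanSpace.inner_eq_star_dotProduct, x, y, dotProduct_comm]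
    rw [← h2, ← h]
    refine Finset.sum_congr rfl fun j _ => ?_
    rw [hy, real_inner_comm x (b j)]
    ring
  rw [← hsq, ← hquad, Finset.mul_sum]
  refine Finset.sum_le_sum fun j _ => ?_
  by_cases h0 : hL.eigenvalues j = 0
  · have hker : (G.incidence * G.incidenceᵀ) *ᵥ (b j).ofLp = 0 := by
      rw [hL.mulVec_eigenvectorBasis j, h0, zero_smul]
    have hc := G.eq_of_laplacian_mulVec_eq_zero hF hker
    have : inner ℝ (b j) x = 0 := by
      rw [hinner, dotProduct, Finset.sum_congr rfl fun i _ => by rw [hc i j], ← Finset.sum_mul, hξ,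
        zero_mul]
    rw [this]
    simp
  · exact mul_le_mul_of_nonneg_right
      (csInf_le (G.decayRate_bddBelow hκ) (mem_insert_of_mem _ ⟨h0, hev j⟩)) (sq_nonneg _)

end Laplacian

/-! ### Boundedness of prices -/

/-- If the edges with unbounded flow functions connect the graph, then the price differences are
bounded in terms of the divergence of the induced flow. If they were large, so would be the
difference across some edge of `F`, and the power `∑ k, y k * q k (y k)` delivered to the edges
would exceed what the nodes supply. -/
theorem exists_bound_of_divergence [Fintype V] [DecidableEq V] [Fintype E]
    (G : OrientedGraph V E) {F : Set E} (hF : (G.sub F).Preconnected) {q : E → ℝ → ℝ}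
    (hq : ∀ k, Monotone (q k)) (htop : ∀ k ∈ F, Tendsto (q k) atTop atTop)
    (hbot : ∀ k ∈ F, Tendsto (q k) atBot atBot) (C : ℝ) :
    ∃ D : ℝ, ∀ ζ : V → ℝ,
      (∀ i, |(G.incidence *ᵥ fun k => q k ((G.incidenceᵀ *ᵥ ζ) k)) i| ≤ C) →
      ∀ i j, |ζ i - ζ j| ≤ D := by
  classical
  set n : ℝ := ((Fintype.card V : ℕ) : ℝ) with hn
  set M : ℝ := ∑ k, |q k 0| with hM
  set K : ℝ := n * (n * C + M) + 1 with hK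
  have hY : ∃ Y : ℝ, 0 ≤ Y ∧ ∀ k ∈ F, ∀ y, Y < |y| → |y| * K ≤ y * q k y := by
    have hk : ∀ k : E, ∃ Y : ℝ, k ∈ F → ∀ y, Y < |y| → |y| * K ≤ y * q k y := by
      intro k
      by_cases hkF : k ∈ F
      · obtain ⟨a, ha⟩ := eventually_atTop.1 ((htop k hkF).eventually_ge_atTop K)
        obtain ⟨b, hb⟩ := eventually_atBot.1 ((hbot k hkF).eventually_le_atBot (-K))
        refine ⟨max a (-b), fun _ y hy => ?_⟩
        obtain ⟨h1, h2⟩ := max_lt_iff.1 hy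
        rcases le_total 0 y with h0 | h0
        · rw [abs_of_nonneg h0] at h1 h2 ⊢
          exact mul_le_mul_of_nonneg_left (ha y h1.le) h0
        · rw [abs_of_nonpos h0] at h1 h2 ⊢
          have := mul_le_mul_of_nonneg_left (hb y (by linarith)) (neg_nonneg.2 h0)
          linarith
      · exact ⟨0, fun h => absurd h hkF⟩
    choose Y hY using hk
    refine ⟨∑ k, |Y k|, Finset.sum_nonneg fun k _ => abs_nonneg _, fun k hkF y hy => ?_⟩
    refine hY k hkF y (lt_of_le_of_lt ((le_abs_self _).trans ?_) hy)
    exact Finset.single_le_sum (f := fun k => |Y k|) (fun k _ => abs_nonneg _) (Finset.mem_univ k)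
  obtain ⟨Y, hY0, hY⟩ := hY
  refine ⟨n * Y, fun ζ hζ => ?_⟩
  rcases isEmpty_or_nonempty V with hV | hV
  · exact fun i => hV.elim i
  have hnpos : 0 < n := by
    rw [hn]
    exact_mod_cast Fintype.card_pos
  obtain ⟨i₁, hi₁⟩ := Finite.exists_max ζ
  obtain ⟨i₀, hi₀⟩ := Finite.exists_min ζ
  set Δ := ζ i₁ - ζ i₀ with hΔ
  suffices hΔY : Δ ≤ n * Y by
    intro i j
    refine le_trans (abs_le.2 ⟨?_, ?_⟩) hΔY <;> linarith [hi₁ i, hi₁ j, hi₀ i, hi₀ j]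
  by_contra! hlt
  have hΔpos : 0 < Δ := lt_of_le_of_lt (mul_nonneg hnpos.le hY0) hlt
  set y : E → ℝ := fun k => ζ (G.src k) - ζ (G.tgt k) with hy
  have hyΔ : ∀ k, |y k| ≤ Δ := fun k => abs_le.2
    ⟨by simp only [hy]; linarith [hi₁ (G.tgt k), hi₀ (G.src k)],
      by simp only [hy]; linarith [hi₁ (G.src k), hi₀ (G.tgt k)]⟩
  -- Some edge of `F` carries at least the fraction `1 / n` of the largest price difference.
  obtain ⟨k₀, hk₀F, hk₀⟩ : ∃ k ∈ F, Δ ≤ n * |y k| := by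
    by_contra! hall
    have hFne : F.Nonempty := by
      by_contra hFe
      rw [not_nonempty_iff_eq_empty] at hFe
      have h := G.abs_sub_le_of_preconnected hF le_rfl
        (fun k (hk : k ∈ F) => by rw [hFe] at hk; exact hk.elim) i₁ i₀ (u := ζ)
      rw [mul_zero] at h
      linarith [le_abs_self (ζ i₁ - ζ i₀)]
    have hfin : (Finset.univ.filter fun k => k ∈ F).Nonempty := by
      obtain ⟨k, hk⟩ := hFne
      exact ⟨k, by simp [hk]⟩
    obtain ⟨k, hk, hmax⟩ := Finset.exists_max_image _ (fun k => |y k|) hfin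
    have h := G.abs_sub_le_of_preconnected hF (abs_nonneg (y k))
      (fun l hl => hmax l (by simp [hl])) i₁ i₀ (u := ζ)
    have := hall k (by simpa using hk)
    linarith [le_abs_self (ζ i₁ - ζ i₀)]
  have hpower : ∑ i, (ζ i - ζ i₀) * (G.incidence *ᵥ fun k => q k ((G.incidenceᵀ *ᵥ ζ) k)) i =
      ∑ k, y k * q k (y k) := by
    have h := G.dotProduct_incidence_mulVec (fun i => ζ i - ζ i₀)
      (fun k => q k ((G.incidenceᵀ *ᵥ ζ) k))
    simp only [sub_sub_sub_cancel_right, transpose_mulVec_apply] at h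
    simp only [transpose_mulVec_apply]
    exact h
  have hsupply : ∑ k, y k * q k (y k) ≤ n * C * Δ := by
    rw [← hpower]
    calc _ ≤ ∑ _i : V, C * Δ := Finset.sum_le_sum fun i _ => by
          have h1 : 0 ≤ ζ i - ζ i₀ := sub_nonneg.2 (hi₀ i)
          have h2 : ζ i - ζ i₀ ≤ Δ := by linarith [hi₁ i]
          have h3 := (le_abs_self _).trans (hζ i)
          have hC : 0 ≤ C := (abs_nonneg _).trans (hζ i)
          calc _ ≤ (ζ i - ζ i₀) * C := mul_le_mul_of_nonneg_left h3 h1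
            _ ≤ C * Δ := by rw [mul_comm]; exact mul_le_mul_of_nonneg_left h2 hC
      _ = n * C * Δ := by
          rw [Finset.sum_const, Finset.card_univ, nsmul_eq_mul]
          ring
  have hterm : ∀ k, -(|q k 0| * Δ) ≤ y k * q k (y k) := by
    intro k
    have h1 : y k * q k 0 ≤ y k * q k (y k) := by
      rcases le_total 0 (y k) with h0 | h0
      · exact mul_le_mul_of_nonneg_left (hq k h0) h0
      · exact mul_le_mul_of_nonpos_left (hq k h0) h0
    have h2 : |y k * q k 0| ≤ |q k 0| * Δ := by
      rw [abs_mul, mul_comm]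
      exact mul_le_mul_of_nonneg_left (hyΔ k) (abs_nonneg _)
    linarith [neg_abs_le (y k * q k 0)]
  have hk₀Y : Y < |y k₀| := lt_of_mul_lt_mul_left (lt_of_lt_of_le hlt hk₀) hnpos.le
  have hbig := hY k₀ hk₀F (y k₀) hk₀Y
  have hdemand : |y k₀| * K - M * Δ ≤ ∑ k, y k * q k (y k) := by
    rw [← Finset.add_sum_erase _ _ (Finset.mem_univ k₀)]
    have h1 : -(M * Δ) ≤ ∑ k ∈ Finset.univ.erase k₀, y k * q k (y k) := by
      calc -(M * Δ) = ∑ k, -(|q k 0| * Δ) := by rw [hM, Finset.sum_mul, Finset.sum_neg_distrib]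
        _ ≤ ∑ k ∈ Finset.univ.erase k₀, -(|q k 0| * Δ) := by
          rw [← Finset.add_sum_erase _ _ (Finset.mem_univ k₀)]
          have : 0 ≤ |q k₀ 0| * Δ := mul_nonneg (abs_nonneg _) hΔpos.le
          linarith
        _ ≤ _ := Finset.sum_le_sum fun k _ => hterm k
    linarith
  have hC : 0 ≤ C := (abs_nonneg _).trans (hζ i₀)
  have hM0 : 0 ≤ M := Finset.sum_nonneg fun k _ => abs_nonneg _
  have hK0 : 0 ≤ K := by positivity
  have hfinal : Δ * K ≤ n * (n * C * Δ + M * Δ) :=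
    calc Δ * K ≤ n * |y k₀| * K := mul_le_mul_of_nonneg_right hk₀ hK0
      _ = n * (|y k₀| * K) := by ring
      _ ≤ n * (n * C * Δ + M * Δ) := mul_le_mul_of_nonneg_left (by linarith) hnpos.le
  rw [hK] at hfinal
  linarith

end OrientedGraph

/-! ### Calculus on the time interval -/

theorem zero_mem_horizon {τ : EReal} {t : ℝ} (ht : t ∈ horizon τ) : (0 : ℝ) ∈ horizon τ :=
  ⟨le_rfl, lt_of_le_of_lt (EReal.coe_le_coe_iff.2 ht.1) ht.2⟩

theorem convex_horizon (τ : EReal) : Convex ℝ (horizon τ) := by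
  have : (horizon τ).OrdConnected := ⟨fun _ ha _ hb _ hs =>
    ⟨ha.1.trans hs.1, lt_of_le_of_lt (EReal.coe_le_coe_iff.2 hs.2) hb.2⟩⟩
  exact this.convex

theorem uniqueDiffWithinAt_horizon {τ : EReal} {t : ℝ} (ht : t ∈ horizon τ) :
    UniqueDiffWithinAt ℝ (horizon τ) t := by
  obtain ⟨b, htb, hbτ⟩ := EReal.lt_iff_exists_real_btwn.1 ht.2
  refine (uniqueDiffOn_Ico 0 b t ⟨ht.1, EReal.coe_lt_coe_iff.1 htb⟩).mono fun r hr => ?_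
  exact ⟨hr.1, lt_trans (EReal.coe_lt_coe_iff.2 hr.2) hbτ⟩

theorem le_of_hasDerivWithinAt_horizon {τ : EReal} {f f' : ℝ → ℝ}
    (hf : ∀ t ∈ horizon τ, HasDerivWithinAt f (f' t) (horizon τ) t)
    (hf' : ∀ t ∈ horizon τ, f' t ≤ 0) {t : ℝ} (ht : t ∈ horizon τ) : f t ≤ f 0 :=
  antitoneOn_of_hasDerivWithinAt_nonpos (convex_horizon τ)
    (fun t ht => (hf t ht).continuousWithinAt)
    (fun t ht => (hf t (interior_subset ht)).mono interior_subset)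
    (fun t ht => hf' t (interior_subset ht)) (zero_mem_horizon ht) ht ht.1

theorem eq_of_hasDerivWithinAt_horizon {τ : EReal} {f : ℝ → ℝ}
    (hf : ∀ t ∈ horizon τ, HasDerivWithinAt f 0 (horizon τ) t) {t : ℝ} (ht : t ∈ horizon τ) :
    f t = f 0 := by
  refine le_antisymm (le_of_hasDerivWithinAt_horizon hf (fun _ _ => le_rfl) ht) ?_
  have h := le_of_hasDerivWithinAt_horizon (f := fun t => -f t) (fun t ht => (hf t ht).neg)
    (fun _ _ => neg_zero.le) ht
  exact neg_le_neg_iff.1 h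

theorem HasDerivWithinAt.matrix_mulVec {m n : Type*} [Fintype m] [Fintype n] (A : Matrix m n ℝ)
    {f : ℝ → n → ℝ} {f' : n → ℝ} {S : Set ℝ} {t : ℝ} (hf : HasDerivWithinAt f f' S t) :
    HasDerivWithinAt (fun t => A *ᵥ f t) (A *ᵥ f') S t := by
  rw [hasDerivWithinAt_pi] at hf ⊢
  intro i
  exact HasDerivWithinAt.fun_sum fun j _ => (hf j).const_mul (A i j)

theorem HasDerivWithinAt.sum_apply {n : Type*} [Fintype n] {f : ℝ → n → ℝ} {f' : n → ℝ}
    {S : Set ℝ} {t : ℝ} (hf : HasDerivWithinAt f f' S t) :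
    HasDerivWithinAt (fun t => ∑ i, f t i) (∑ i, f' i) S t :=
  HasDerivWithinAt.fun_sum fun i _ => hasDerivWithinAt_pi.1 hf i

/-! ### The closed loop -/

section Network

theorem sum_sub_average {V : Type*} [Fintype V] (u : V → ℝ) : ∑ i, (u i - average u) = 0 := by
  rcases isEmpty_or_nonempty V with hV | hV
  · simp
  · have : (Fintype.card V : ℝ) ≠ 0 := by exact_mod_cast Fintype.card_ne_zero
    rw [Finset.sum_sub_distrib, Finset.sum_const, Finset.card_univ, nsmul_eq_mul, average]
    field_simp
    ring

theorem continuous_dualFlow {V E : Type*} [Fintype V] [DecidableEq V] (G : OrientedGraph V E)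
    {cap : E → ℝ≥0∞} (hcap : ∀ k, 0 < cap k) {cost : E → ℝ → EReal}
    (hcost : ∀ k, IsLegendreCost (cap k) (cost k)) : Continuous (dualFlow G cap cost) :=
  continuous_pi fun k => ((hcost k).continuous_gradInv (hcap k)).comp
    ((continuous_apply k).comp (continuous_const.matrix_mulVec continuous_id))

variable {V E R : Type*} [Fintype V] [DecidableEq V] [Fintype E] [Fintype R]

theorem meanProj_mulVec (u : V → ℝ) : meanProj V *ᵥ u = fun i => u i - average u := by
  ext i
  rw [meanProj, Matrix.sub_mulVec, Matrix.one_mulVec, Matrix.smul_mulVec]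
  simp [average, Matrix.mulVec, dotProduct]

theorem sum_flowResidual (G : OrientedGraph V E) (cap : E → ℝ≥0∞) (cost : E → ℝ → EReal)
    (P : Matrix V R ℝ) (ζ : V → ℝ) (w : R → ℝ) :
    ∑ i, flowResidual G cap cost P ζ w i = ∑ i, (P *ᵥ w) i := by
  simp only [flowResidual, Pi.add_apply, Finset.sum_add_distrib, G.sum_incidence_mulVec, zero_add]

/-- `Q Ξ(ζ)` is a right inverse of the weighted Laplacian `B H Bᵀ` on the vectors of zero sum:
`B H Bᵀ Q Ξ` removes the mean. -/
theorem weightedLaplacian_mul_xiMatrix_mulVec [DecidableEq E] (G : OrientedGraph V E)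
    (cap : E → ℝ≥0∞) (cost : E → ℝ → EReal) {F : Set E} (hF : (G.sub F).Preconnected) {ζ : V → ℝ}
    (hh : ∀ k, 0 < edgeWeight G cap cost ζ k) (v : V → ℝ) :
    G.incidence *ᵥ (Matrix.diagonal (edgeWeight G cap cost ζ) *ᵥ
      (G.incidenceᵀ *ᵥ ((meanProj V * xiMatrix G cap cost ζ) *ᵥ v))) =
      fun i => v i - average v := by
  rcases isEmpty_or_nonempty V with hV | hV
  · exact Subsingleton.elim _ _
  have hX := G.treeMatrix_spec ⟨hF⟩ hh
  have hdiag : Matrix.diagonal (edgeWeight G cap cost ζ) *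
      Matrix.diagonal (fun k => (edgeWeight G cap cost ζ k)⁻¹) = 1 := by
    rw [Matrix.diagonal_mul_diagonal, ← Matrix.diagonal_one]
    congr 1
    ext k
    exact mul_inv_cancel₀ (hh k).ne'
  have hmat : G.incidence * Matrix.diagonal (edgeWeight G cap cost ζ) * G.incidenceᵀ *
      xiMatrix G cap cost ζ = G.incidence * G.incidenceᵀ * gramPinv G.incidence := by
    rw [xiMatrix, ← Matrix.mul_assoc, ← Matrix.mul_assoc, ← Matrix.mul_assoc, hX,
      Matrix.mul_assoc G.incidence, hdiag, Matrix.mul_one]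
  rw [← Matrix.mulVec_mulVec, meanProj_mulVec, G.transpose_mulVec_sub_const, Matrix.mulVec_mulVec,
    Matrix.mulVec_mulVec, Matrix.mulVec_mulVec, hmat]
  have hsplit : v = (fun i => v i - average v) + fun _ => average v := by
    ext i
    simp
  conv_lhs => rw [hsplit]
  rw [Matrix.mulVec_add, G.laplacian_mul_gramPinv_mulVec hF (sum_sub_average v),
    G.laplacian_mul_gramPinv_mulVec_const, add_zero]

theorem incidence_mulVec_pricePsi_add (G : OrientedGraph V E) (cap : E → ℝ≥0∞)
    (cost : E → ℝ → EReal) (P : Matrix V R ℝ) (ζ x : V → ℝ) (w : R → ℝ) :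
    G.incidence *ᵥ pricePsi G cap cost ζ x + P *ᵥ w =
      flowResidual G cap cost P ζ w - (G.incidence * G.incidenceᵀ) *ᵥ x := by
  rw [pricePsi, flowResidual, Matrix.mulVec_sub, Matrix.mulVec_mulVec]
  abel

theorem storage_eq (G : OrientedGraph V E) (cap : E → ℝ≥0∞) (cost : E → ℝ → EReal)
    (P : Matrix V R ℝ) (ξ ζ : V → ℝ) (w : R → ℝ) : storage G cap cost P ξ ζ w =
      ∑ i, (1 / 2) * (ξ i ^ 2 + flowResidual G cap cost P ζ w i ^ 2) := by
  rw [storage, ← Finset.mul_sum, Finset.sum_add_distrib, mul_add]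

theorem storage_nonneg (G : OrientedGraph V E) (cap : E → ℝ≥0∞) (cost : E → ℝ → EReal)
    (P : Matrix V R ℝ) (ξ ζ : V → ℝ) (w : R → ℝ) : 0 ≤ storage G cap cost P ξ ζ w := by
  rw [storage_eq]
  exact Finset.sum_nonneg fun i _ => by positivity

theorem sq_add_sq_le_storage (G : OrientedGraph V E) (cap : E → ℝ≥0∞) (cost : E → ℝ → EReal)
    (P : Matrix V R ℝ) (ξ ζ : V → ℝ) (w : R → ℝ) (i : V) :
    ξ i ^ 2 + flowResidual G cap cost P ζ w i ^ 2 ≤ 2 * storage G cap cost P ξ ζ w := by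
  have h := Finset.single_le_sum
    (f := fun i => (1 / 2) * (ξ i ^ 2 + flowResidual G cap cost P ζ w i ^ 2))
    (fun i _ => by positivity) (Finset.mem_univ i)
  rw [← storage_eq] at h
  linarith

section Smooth

variable (G : OrientedGraph V E) (P : Matrix V R ℝ) {cap : E → ℝ≥0∞} (hcap : ∀ k, 0 < cap k)
  {cost : E → ℝ → EReal} (hcost : ∀ k, IsLegendreCost (cap k) (cost k))

include hcap hcost

theorem continuous_flowResidual :
    Continuous fun q : (V → ℝ) × (R → ℝ) => flowResidual G cap cost P q.1 q.2 :=
  (continuous_const.matrix_mulVec ((continuous_dualFlow G hcap hcost).comp continuous_fst)).add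
    (continuous_const.matrix_mulVec continuous_snd)

theorem hasDerivWithinAt_dualFlow [DecidableEq E] {ζ : ℝ → V → ℝ} {ζ' : V → ℝ} {S : Set ℝ} {t : ℝ}
    (hζ : HasDerivWithinAt ζ ζ' S t) :
    HasDerivWithinAt (fun t => dualFlow G cap cost (ζ t))
      (Matrix.diagonal (edgeWeight G cap cost (ζ t)) *ᵥ (G.incidenceᵀ *ᵥ ζ')) S t := by
  rw [hasDerivWithinAt_pi]
  intro k
  rw [Matrix.mulVec_diagonal]
  exact ((hcost k).hasDerivAt_gradInv (hcap k) _).comp_hasDerivWithinAt t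
    (hasDerivWithinAt_pi.1 (hζ.matrix_mulVec G.incidenceᵀ) k)

end Smooth

section Solution

variable [DecidableEq E] {G : OrientedGraph V E} {P : Matrix V R ℝ}
  {s : (R → ℝ) → (R → ℝ)} {W : Set (R → ℝ)}
  {cap : E → ℝ≥0∞} {cost : E → ℝ → EReal} {κ : ℝ} {τ : EReal} {x : ℝ → V → ℝ} {w : ℝ → R → ℝ}
  {ζ : ℝ → V → ℝ}
  (hsol : IsClosedLoopSolution G P s W (pricePhi G cap cost P s κ) (pricePsi G cap cost) τ x w ζ)

include hsol

theorem sum_inventory_eq {t : ℝ} (ht : t ∈ horizon τ) : ∑ i, x t i = ∑ i, x 0 i := by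
  refine eq_of_hasDerivWithinAt_horizon (f := fun t => ∑ i, x t i) (fun t ht => ?_) ht
  have h := (hsol.inventory t ht).sum_apply
  simpa only [Pi.add_apply, Finset.sum_add_distrib, G.sum_incidence_mulVec, hsol.balanced t ht,
    add_zero] using h

theorem average_inventory_eq {t : ℝ} (ht : t ∈ horizon τ) : average (x t) = average (x 0) := by
  rw [average, average, sum_inventory_eq hsol ht]

theorem sum_price_eq {t : ℝ} (ht : t ∈ horizon τ) : ∑ i, ζ t i = ∑ i, ζ 0 i := by
  refine eq_of_hasDerivWithinAt_horizon (f := fun t => ∑ i, ζ t i) (fun t ht => ?_) ht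
  have h := (hsol.controller t ht).sum_apply
  simpa only [pricePhi, Pi.neg_apply, Finset.sum_neg_distrib, ← Matrix.mulVec_mulVec,
    meanProj_mulVec, sum_sub_average, neg_zero] using h

/-- Differentiating the balance condition; at `t = 0` this uses that the one-sided derivative on
the nondegenerate interval is unique. -/
theorem sum_supply_rate_eq_zero {t : ℝ} (ht : t ∈ horizon τ) : ∑ i, (P *ᵥ s (w t)) i = 0 := by
  have h := ((hsol.exo t ht).matrix_mulVec P).sum_apply
  exact (uniqueDiffWithinAt_horizon ht).eq_deriv _ h
    ((hasDerivWithinAt_const t _ (0 : ℝ)).congr (fun r hr => hsol.balanced r hr)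
      (hsol.balanced t ht))

/-- Along closed-loop solutions `Z' = -ξ - κ Z`: the controller cancels the supply rate `P s(w)`,
which has zero sum, and replaces it by the deviation `-ξ` of the inventory and the damping
`-κ Z`. -/
theorem hasDerivWithinAt_flowResidual (hcap : ∀ k, 0 < cap k)
    (hcost : ∀ k, IsLegendreCost (cap k) (cost k)) {F : Set E} (hF : (G.sub F).Preconnected)
    {t : ℝ} (ht : t ∈ horizon τ) :
    HasDerivWithinAt (fun t => flowResidual G cap cost P (ζ t) (w t))
      (fun i => -(x t i - average (x 0)) - κ * flowResidual G cap cost P (ζ t) (w t) i)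
      (horizon τ) t := by
  have h := ((hasDerivWithinAt_dualFlow G hcap hcost (hsol.controller t ht)).matrix_mulVec
    G.incidence).add ((hsol.exo t ht).matrix_mulVec P)
  refine h.congr_deriv ?_
  have hh : ∀ k, 0 < edgeWeight G cap cost (ζ t) k := fun k =>
    (hcost k).deriv_gradInv_pos (hcap k) _
  rw [pricePhi, Matrix.mulVec_neg, Matrix.mulVec_neg, Matrix.mulVec_neg,
    weightedLaplacian_mul_xiMatrix_mulVec G cap cost hF hh]
  have havg : average (P *ᵥ s (w t) + x t + κ • flowResidual G cap cost P (ζ t) (w t)) =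
      average (x 0) := by
    rw [← average_inventory_eq hsol ht]
    simp only [average, Pi.add_apply, Pi.smul_apply, smul_eq_mul, Finset.sum_add_distrib,
      ← Finset.mul_sum, sum_flowResidual, hsol.balanced t ht, sum_supply_rate_eq_zero hsol ht,
      zero_add, mul_zero, add_zero]
  rw [havg]
  ext i
  simp only [Pi.add_apply, Pi.neg_apply, Pi.smul_apply, smul_eq_mul]
  ring

theorem hasDerivWithinAt_storage (hcap : ∀ k, 0 < cap k)
    (hcost : ∀ k, IsLegendreCost (cap k) (cost k)) {F : Set E} (hF : (G.sub F).Preconnected)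
    {t : ℝ} (ht : t ∈ horizon τ) :
    HasDerivWithinAt
      (fun t => storage G cap cost P (fun i => x t i - average (x 0)) (ζ t) (w t))
      (-((fun i => x t i - average (x 0)) ⬝ᵥ
          ((G.incidence * G.incidenceᵀ) *ᵥ fun i => x t i - average (x 0))) -
        κ * ∑ i, flowResidual G cap cost P (ζ t) (w t) i ^ 2) (horizon τ) t := by
  have hx : ∀ i, HasDerivWithinAt (fun t => x t i - average (x 0))
      (flowResidual G cap cost P (ζ t) (w t) i -
        ((G.incidence * G.incidenceᵀ) *ᵥ fun i => x t i - average (x 0)) i) (horizon τ) t := by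
    intro i
    refine (hasDerivWithinAt_pi.1 (hsol.inventory t ht) i).sub_const (average (x 0))
      |>.congr_deriv ?_
    rw [incidence_mulVec_pricePsi_add, Pi.sub_apply, ← Matrix.mulVec_mulVec, ← Matrix.mulVec_mulVec,
      G.transpose_mulVec_sub_const]
  have hZ := hasDerivWithinAt_pi.1 (hasDerivWithinAt_flowResidual hsol hcap hcost hF ht)
  simp only [storage_eq]
  refine (HasDerivWithinAt.fun_sum fun i _ =>
    (((hx i).pow 2).add ((hZ i).pow 2)).const_mul (1 / 2 : ℝ)).congr_deriv ?_
  rw [dotProduct, ← Finset.sum_neg_distrib, Finset.mul_sum, ← Finset.sum_sub_distrib]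
  refine Finset.sum_congr rfl fun i _ => ?_
  push_cast
  ring

/-- The cross terms of the two parts of the storage function cancel, and each part decays at a
rate of at least `2 * decayRate G κ`. -/
theorem storage_le (hcap : ∀ k, 0 < cap k)
    (hcost : ∀ k, IsLegendreCost (cap k) (cost k)) {F : Set E} (hF : (G.sub F).Preconnected)
    (hκ : 0 < κ) {t : ℝ} (ht : t ∈ horizon τ) :
    storage G cap cost P (fun i => x t i - average (x 0)) (ζ t) (w t) ≤
      Real.exp (-(decayRate G κ) * t) *
        storage G cap cost P (fun i => x 0 i - average (x 0)) (ζ 0) (w 0) := by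
  set σ := decayRate G κ with hσ
  set U : ℝ → ℝ := fun t => storage G cap cost P (fun i => x t i - average (x 0)) (ζ t) (w t)
    with hU
  have hσ0 : 0 < σ := G.decayRate_pos hκ
  have hderiv : ∀ t ∈ horizon τ, HasDerivWithinAt (fun t => Real.exp (σ * t) * U t)
      (Real.exp (σ * t) * (σ * 1) * U t + Real.exp (σ * t) *
        (-((fun i => x t i - average (x 0)) ⬝ᵥ
          ((G.incidence * G.incidenceᵀ) *ᵥ fun i => x t i - average (x 0))) -
        κ * ∑ i, flowResidual G cap cost P (ζ t) (w t) i ^ 2)) (horizon τ) t := fun t ht =>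
    (((hasDerivAt_id t).const_mul σ).exp.hasDerivWithinAt).mul
      (hasDerivWithinAt_storage hsol hcap hcost hF ht)
  have hle := le_of_hasDerivWithinAt_horizon hderiv (fun t ht => ?_) ht
  · simp only [mul_zero, Real.exp_zero, one_mul] at hle
    calc U t = Real.exp (-σ * t) * (Real.exp (σ * t) * U t) := by
          rw [← mul_assoc, ← Real.exp_add, neg_mul, neg_add_cancel, Real.exp_zero, one_mul]
      _ ≤ Real.exp (-σ * t) * U 0 := mul_le_mul_of_nonneg_left hle (Real.exp_pos _).le
  · have hsum : ∑ i, (x t i - average (x 0)) = 0 := by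
      rw [← average_inventory_eq hsol ht]
      exact sum_sub_average (x t)
    have h1 := G.decayRate_mul_le hF hκ hsum
    have h2 : σ * ∑ i, flowResidual G cap cost P (ζ t) (w t) i ^ 2 ≤
        κ * ∑ i, flowResidual G cap cost P (ζ t) (w t) i ^ 2 :=
      mul_le_mul_of_nonneg_right (G.decayRate_le hκ) (Finset.sum_nonneg fun i _ => sq_nonneg _)
    have h3 : 0 ≤ σ * U t := mul_nonneg hσ0.le (storage_nonneg G cap cost P _ _ _)
    have h4 : σ * U t = 1 / 2 * (σ * ∑ i, (x t i - average (x 0)) ^ 2) +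
        1 / 2 * (σ * ∑ i, flowResidual G cap cost P (ζ t) (w t) i ^ 2) := by
      rw [hU]
      simp only [storage]
      ring
    rw [mul_one, mul_assoc, ← mul_add]
    refine mul_nonpos_of_nonneg_of_nonpos (Real.exp_pos _).le ?_
    linarith

theorem storage_le_initial (hcap : ∀ k, 0 < cap k)
    (hcost : ∀ k, IsLegendreCost (cap k) (cost k)) {F : Set E} (hF : (G.sub F).Preconnected)
    (hκ : 0 < κ) {t : ℝ} (ht : t ∈ horizon τ) :
    storage G cap cost P (fun i => x t i - average (x 0)) (ζ t) (w t) ≤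
      storage G cap cost P (fun i => x 0 i - average (x 0)) (ζ 0) (w 0) := by
  refine (storage_le hsol hcap hcost hF hκ ht).trans
    (mul_le_of_le_one_left (storage_nonneg G cap cost P _ _ _) ?_)
  rw [Real.exp_le_one_iff, neg_mul, neg_nonpos]
  exact mul_nonneg (G.decayRate_pos hκ).le ht.1

/-- Closed-loop solutions are bounded: the storage function bounds the inventory and the residual,
and the residual bounds the price differences, while the mean price is constant. -/
theorem exists_bound (hW : IsCompact W) (hinv : ForwardInvariant s W) (hcap : ∀ k, 0 < cap k)
    (hcost : ∀ k, IsLegendreCost (cap k) (cost k))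
    (hF : (G.sub {k | cap k = ⊤}).Preconnected) (hκ : 0 < κ) :
    ∃ C : ℝ, ∀ t ∈ horizon τ, ‖x t‖ ≤ C ∧ ‖w t‖ ≤ C ∧ ‖ζ t‖ ≤ C := by
  obtain ⟨C₁, hC₁⟩ := hW.exists_bound_of_continuousOn continuousOn_id
  obtain ⟨C₂, hC₂⟩ := hW.exists_bound_of_continuousOn (f := fun w => P *ᵥ w)
    (continuous_const.matrix_mulVec continuous_id).continuousOn
  set r := Real.sqrt (2 * storage G cap cost P (fun i => x 0 i - average (x 0)) (ζ 0) (w 0))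
    with hr
  have hw : ∀ t ∈ horizon τ, w t ∈ W := hinv τ w hsol.exo hsol.init_mem
  have hbd : ∀ t ∈ horizon τ, ∀ i, |x t i - average (x 0)| ≤ r ∧
      |flowResidual G cap cost P (ζ t) (w t) i| ≤ r := by
    intro t ht i
    have h1 := sq_add_sq_le_storage G cap cost P (fun i => x t i - average (x 0)) (ζ t) (w t) i
    have h2 := storage_le_initial hsol hcap hcost hF hκ ht
    exact ⟨Real.abs_le_sqrt (by nlinarith [sq_nonneg (flowResidual G cap cost P (ζ t) (w t) i)]),
      Real.abs_le_sqrt (by nlinarith [sq_nonneg (x t i - average (x 0))])⟩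
  obtain ⟨D, hD⟩ := G.exists_bound_of_divergence hF
    (q := fun k => gradInv (cap k) (cost k)) (fun k => (hcost k).monotone_gradInv (hcap k))
    (fun k (hk : cap k = ⊤) => by
      have h := hcost k
      rw [hk] at h ⊢
      exact h.tendsto_gradInv_atTop)
    (fun k (hk : cap k = ⊤) => by
      have h := hcost k
      rw [hk] at h ⊢
      exact h.tendsto_gradInv_atBot) (r + C₂)
  have hζ : ∀ t ∈ horizon τ, ∀ i, |ζ t i| ≤ |D| + |∑ i, ζ 0 i| := by
    intro t ht i
    have hdiff := hD (ζ t) fun i => by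
      have h1 : (G.incidence *ᵥ fun k => gradInv (cap k) (cost k) ((G.incidenceᵀ *ᵥ ζ t) k)) i =
          flowResidual G cap cost P (ζ t) (w t) i - (P *ᵥ w t) i := by
        rw [flowResidual, Pi.add_apply, add_sub_cancel_right]
        rfl
      rw [h1]
      exact (abs_sub _ _).trans (add_le_add (hbd t ht i).2
        ((norm_le_pi_norm (P *ᵥ w t) i).trans (hC₂ _ (hw t ht))))
    have hn : (1 : ℝ) ≤ Fintype.card V := by
      exact_mod_cast Fintype.card_pos_iff.2 ⟨i⟩
    have hmean : (Fintype.card V : ℝ) * ζ t i = ∑ j, (ζ t i - ζ t j) + ∑ j, ζ 0 j := by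
      rw [← sum_price_eq hsol ht, Finset.sum_sub_distrib, Finset.sum_const, Finset.card_univ,
        nsmul_eq_mul]
      ring
    have h2 : (Fintype.card V : ℝ) * |ζ t i| ≤
        Fintype.card V * (|D| + |∑ i, ζ 0 i|) := by
      calc (Fintype.card V : ℝ) * |ζ t i| = |∑ j, (ζ t i - ζ t j) + ∑ j, ζ 0 j| := by
            rw [← hmean, abs_mul, Nat.abs_cast]
        _ ≤ |∑ j, (ζ t i - ζ t j)| + |∑ j, ζ 0 j| := abs_add_le _ _
        _ ≤ Fintype.card V * |D| + Fintype.card V * |∑ j, ζ 0 j| := by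
            refine add_le_add ?_ (le_mul_of_one_le_left (abs_nonneg _) hn)
            refine (Finset.abs_sum_le_sum_abs _ _).trans ?_
            refine (Finset.sum_le_card_nsmul _ _ |D| fun j _ =>
              (hdiff i j).trans (le_abs_self D)).trans ?_
            rw [Finset.card_univ, nsmul_eq_mul]
        _ = _ := by ring
    exact le_of_mul_le_mul_left h2 (by linarith)
  refine ⟨max (r + |average (x 0)|) (max C₁ (|D| + |∑ i, ζ 0 i|)), fun t ht => ⟨?_, ?_, ?_⟩⟩
  · refine le_trans ((pi_norm_le_iff_of_nonneg (by positivity)).2 fun i => ?_) (le_max_left _ _)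
    rw [Real.norm_eq_abs]
    calc |x t i| = |(x t i - average (x 0)) + average (x 0)| := by rw [sub_add_cancel]
      _ ≤ r + |average (x 0)| := (abs_add_le _ _).trans (add_le_add (hbd t ht i).1 le_rfl)
  · exact (hC₁ _ (hw t ht)).trans ((le_max_left _ _).trans (le_max_right _ _))
  · exact ((pi_norm_le_iff_of_nonneg (by positivity)).2 fun i => hζ t ht i).trans
      ((le_max_right _ _).trans (le_max_right _ _))

end Solution

section Limit

variable [DecidableEq E] {G : OrientedGraph V E} {P : Matrix V R ℝ}
  {s : (R → ℝ) → (R → ℝ)} {W : Set (R → ℝ)}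
  {cap : E → ℝ≥0∞} {cost : E → ℝ → EReal} {κ : ℝ} {x : ℝ → V → ℝ} {w : ℝ → R → ℝ}
  {ζ : ℝ → V → ℝ}
  (hsol : IsClosedLoopSolution G P s W (pricePhi G cap cost P s κ) (pricePsi G cap cost) ⊤ x w ζ)

theorem mem_horizon_top {t : ℝ} (ht : 0 ≤ t) : t ∈ horizon ⊤ := ⟨ht, EReal.coe_lt_top t⟩

include hsol

theorem tendsto_sub_average_and_flowResidual (hcap : ∀ k, 0 < cap k)
    (hcost : ∀ k, IsLegendreCost (cap k) (cost k)) {F : Set E} (hF : (G.sub F).Preconnected)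
    (hκ : 0 < κ) (i : V) :
    Tendsto (fun t => x t i - average (x 0)) atTop (𝓝 0) ∧
      Tendsto (fun t => flowResidual G cap cost P (ζ t) (w t) i) atTop (𝓝 0) := by
  set U₀ := storage G cap cost P (fun i => x 0 i - average (x 0)) (ζ 0) (w 0) with hU₀
  have hlim : Tendsto (fun t => Real.sqrt (2 * (Real.exp (-(decayRate G κ) * t) * U₀))) atTop
      (𝓝 0) := by
    have h1 : Tendsto (fun t => Real.exp (-(decayRate G κ) * t)) atTop (𝓝 0) :=
      Real.tendsto_exp_atBot.comp
        (tendsto_id.const_mul_atTop_of_neg (neg_lt_zero.2 (G.decayRate_pos hκ)))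
    have h2 := ((h1.mul_const U₀).const_mul 2).sqrt
    simpa using h2
  have hle : ∀ᶠ t in atTop, |x t i - average (x 0)| ≤
        Real.sqrt (2 * (Real.exp (-(decayRate G κ) * t) * U₀)) ∧
      |flowResidual G cap cost P (ζ t) (w t) i| ≤
        Real.sqrt (2 * (Real.exp (-(decayRate G κ) * t) * U₀)) := by
    filter_upwards [eventually_ge_atTop 0] with t ht
    have h1 := sq_add_sq_le_storage G cap cost P (fun i => x t i - average (x 0)) (ζ t) (w t) i
    have h2 := storage_le hsol hcap hcost hF hκ (mem_horizon_top ht)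
    exact ⟨Real.abs_le_sqrt (by nlinarith [sq_nonneg (flowResidual G cap cost P (ζ t) (w t) i)]),
      Real.abs_le_sqrt (by nlinarith [sq_nonneg (x t i - average (x 0))])⟩
  exact ⟨squeeze_zero_norm' (hle.mono fun t h => h.1) hlim,
    squeeze_zero_norm' (hle.mono fun t h => h.2) hlim⟩

theorem tendsto_transpose_mulVec (hcap : ∀ k, 0 < cap k)
    (hcost : ∀ k, IsLegendreCost (cap k) (cost k)) {F : Set E} (hF : (G.sub F).Preconnected)
    (hκ : 0 < κ) : Tendsto (fun t => G.incidenceᵀ *ᵥ x t) atTop (𝓝 0) := by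
  rw [tendsto_pi_nhds]
  intro k
  have h := (tendsto_sub_average_and_flowResidual hsol hcap hcost hF hκ (G.src k)).1.sub
    (tendsto_sub_average_and_flowResidual hsol hcap hcost hF hκ (G.tgt k)).1
  simpa only [G.transpose_mulVec_apply, sub_sub_sub_cancel_right, sub_zero, Pi.zero_apply] using h

/-- Every limit point `(ζ, w)` of the bounded trajectory has zero residual, so it defines a point
of `optimalPairs`, to which the pair of flow and supply converges along the same times. -/
theorem tendsto_distTo_optimalPairs (hW : IsCompact W) (hinv : ForwardInvariant s W)
    (hcap : ∀ k, 0 < cap k) (hcost : ∀ k, IsLegendreCost (cap k) (cost k))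
    (hF : (G.sub {k | cap k = ⊤}).Preconnected) (hκ : 0 < κ) :
    Tendsto (fun t => distTo (optimalPairs G cap cost P W)
      (pricePsi G cap cost (ζ t) (x t), w t)) atTop (𝓝 0) := by
  refine tendsto_of_subseq_tendsto fun ns hns => ?_
  obtain ⟨C, hC⟩ := exists_bound hsol hW hinv hcap hcost hF hκ
  have hw := hinv ⊤ w hsol.exo hsol.init_mem
  have hmem : ∀ᶠ l in atTop, (ζ (ns l), w (ns l)) ∈ Metric.closedBall (0 : V → ℝ) C ×ˢ W := by
    filter_upwards [hns.eventually_ge_atTop 0] with l hl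
    have hl' := mem_horizon_top hl
    exact ⟨by simpa using (hC _ hl').2.2, hw _ hl'⟩
  obtain ⟨⟨ζ', w'⟩, hK, φ, hφ, hlim⟩ :=
    ((isCompact_closedBall (0 : V → ℝ) C).prod hW).tendsto_subseq' hmem.frequently
  have htime : Tendsto (fun l => ns (φ l)) atTop atTop := hns.comp hφ.tendsto_atTop
  have hres : flowResidual G cap cost P ζ' w' = 0 := by
    refine tendsto_nhds_unique
      (((continuous_flowResidual G P hcap hcost).tendsto (ζ', w')).comp hlim) ?_
    rw [tendsto_pi_nhds]
    exact fun i => (tendsto_sub_average_and_flowResidual hsol hcap hcost hF hκ i).2.comp htime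
  have hopt : (dualFlow G cap cost ζ', w') ∈ optimalPairs G cap cost P W :=
    ⟨hK.2, fun k => (hcost k).gradInv_mem (hcap k) _,
      ⟨ζ', funext fun k => (hcost k).costGrad_gradInv (hcap k) _⟩, hres⟩
  have hζ : Tendsto (fun l => ζ (ns (φ l))) atTop (𝓝 ζ') :=
    (continuous_fst.tendsto (ζ', w')).comp hlim
  have hw' : Tendsto (fun l => w (ns (φ l))) atTop (𝓝 w') :=
    (continuous_snd.tendsto (ζ', w')).comp hlim
  have hflow : Tendsto (fun l => pricePsi G cap cost (ζ (ns (φ l))) (x (ns (φ l)))) atTop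
      (𝓝 (dualFlow G cap cost ζ')) := by
    have h := (((continuous_dualFlow G hcap hcost).tendsto ζ').comp hζ).sub
      ((tendsto_transpose_mulVec hsol hcap hcost hF hκ).comp htime)
    rw [sub_zero] at h
    exact h
  refine ⟨φ, tendsto_of_tendsto_of_tendsto_of_le_of_le tendsto_const_nhds ?_
    (fun _ => zero_le) (fun l => iInf₂_le (dualFlow G cap cost ζ', w') hopt)⟩
  have h1 : Tendsto (fun l => ∑ k, (dualFlow G cap cost ζ' k -
      pricePsi G cap cost (ζ (ns (φ l))) (x (ns (φ l))) k) ^ 2 +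
        ∑ j, (w' j - w (ns (φ l)) j) ^ 2) atTop
      (𝓝 (∑ k, (dualFlow G cap cost ζ' k - dualFlow G cap cost ζ' k) ^ 2 +
        ∑ j, (w' j - w' j) ^ 2)) :=
    (tendsto_finsetSum _ fun k _ =>
      (tendsto_const_nhds.sub (tendsto_pi_nhds.1 hflow k)).pow 2).add
    (tendsto_finsetSum _ fun j _ =>
      (tendsto_const_nhds.sub (tendsto_pi_nhds.1 hw' j)).pow 2)
  simpa using ENNReal.tendsto_ofReal h1.sqrt

end Limit

end Network

theorem theorem1 {V E R : Type*} [Fintype V] [DecidableEq V] [Fintype E] [DecidableEq E]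
    [Fintype R]
    (G : OrientedGraph V E) (P : Matrix V R ℝ)
    (s : (R → ℝ) → (R → ℝ)) (W : Set (R → ℝ)) (hW : IsCompact W) (hinv : ForwardInvariant s W)
    (cap : E → ℝ≥0∞) (hcap : ∀ k, 0 < cap k)
    (cost : E → ℝ → EReal) (hcost : ∀ k, IsLegendreCost (cap k) (cost k))
    (hcut : ∀ S : Set V, S.Nonempty → S ≠ Set.univ → G.cutCapacity cap S = ⊤)
    (κ : ℝ) (hκ : 0 < κ) :
    SolvesOptimalDistribution G cap cost P s W
      (pricePhi G cap cost P s κ) (pricePsi G cap cost) ∧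
    0 < decayRate G κ ∧
    ∀ (τ : EReal) (x : ℝ → V → ℝ) (w : ℝ → R → ℝ) (ζ : ℝ → V → ℝ),
      IsClosedLoopSolution G P s W (pricePhi G cap cost P s κ) (pricePsi G cap cost) τ x w ζ →
      ∀ t ∈ horizon τ,
        storage G cap cost P (fun i => x t i - average (x 0)) (ζ t) (w t) ≤
          Real.exp (-(decayRate G κ) * t) *
            storage G cap cost P (fun i => x 0 i - average (x 0)) (ζ 0) (w 0) := by

  have hF := G.preconnected_of_cutCapacity hcut
  refine ⟨fun τ x w ζ hsol => ⟨exists_bound hsol hW hinv hcap hcost hF hκ, ?_⟩,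
    G.decayRate_pos hκ, fun τ x w ζ hsol t ht => storage_le hsol hcap hcost hF hκ ht⟩
  rintro rfl
  exact ⟨tendsto_transpose_mulVec hsol hcap hcost hF hκ,
    tendsto_distTo_optimalPairs hsol hW hinv hcap hcost hF hκ⟩
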